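/- Let $(M,g)$ be a smooth Riemannian manifold (Hausdorff, without boundary, of any finite dimension) with Levi-Civita connection $\nabla$. A magnetic field on $M$ is a smooth closed $2$-form $F$ on $M$; its Lorentz force is the skew-symmetric endomorphism field $\Phi$ of $TM$ given by $g(\Phi(X),Y)=F(X,Y)$. A magnetic curve of $(M,g,F)$ is a smooth curve $\gamma:J\to M$ on a non-empty open interval $J\subseteq\mathbb{R}$ (bounded or not) with $\nabla_{\gamma'}\gamma'=\Phi(\gamma')$ on $J$; it is inextendible if it is not the restriction of a magnetic curve of $(M,g,F)$ defined on a strictly larger open interval. Geodesics are the smooth curves with $\nabla_{\gamma'}\gamma'=0$, with the same notion of inextendibility, and $(M,g)$ is geodesically complete if every inextendible geodesic is defined on all of $\mathbb{R}$. If $(M,g)$ is geodesically complete and $F$ is any magnetic field on $M$, then every inextendible magnetic curve of $(M,g,F)$ is defined on all of $\mathbb{R}$. -/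

import Mathlib

open Set Filter Topology Manifold
open scoped ContDiff

noncomputable section

namespace MagneticCurves

section Tensors

variable {E : Type*} [NormedAddCommGroup E] [NormedSpace ℝ E]
  {M : Type*} [TopologicalSpace M] [ChartedSpace E M]

/-- The local expression in the chart `e` of a family `b` of bilinear forms on the tangent spaces
of `M`: the bilinear form `b (∂_v, ∂_w)` at the point with coordinates `y`, where `∂_v` is the
image of the constant vector `v` under the differential of the inverse chart. -/
def localRep (b : ∀ x : M, TangentSpace 𝓘(ℝ, E) x →L[ℝ] TangentSpace 𝓘(ℝ, E) x →L[ℝ] ℝ)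
    (e : OpenPartialHomeomorph M E) (y : E) : E →L[ℝ] E →L[ℝ] ℝ :=
  let D : E →L[ℝ] TangentSpace 𝓘(ℝ, E) (e.symm y) := mfderiv 𝓘(ℝ, E) 𝓘(ℝ, E) e.symm y
  (ContinuousLinearMap.precomp ℝ D) ∘L (b (e.symm y)) ∘L D

theorem localRep_apply
    (b : ∀ x : M, TangentSpace 𝓘(ℝ, E) x →L[ℝ] TangentSpace 𝓘(ℝ, E) x →L[ℝ] ℝ)
    (e : OpenPartialHomeomorph M E) (y v w : E) :
    localRep b e y v w = b (e.symm y) (mfderiv 𝓘(ℝ, E) 𝓘(ℝ, E) e.symm y v)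
      (mfderiv 𝓘(ℝ, E) 𝓘(ℝ, E) e.symm y w) :=
  rfl

end Tensors

section Forms

variable (E : Type*) [NormedAddCommGroup E] [NormedSpace ℝ E]
  (M : Type*) [TopologicalSpace M] [ChartedSpace E M] [IsManifold 𝓘(ℝ, E) ∞ M]

/-- A smooth Riemannian metric on the manifold `M`. -/
abbrev RiemMetric :=
  Bundle.ContMDiffRiemannianMetric 𝓘(ℝ, E) ∞ E (fun x : M ↦ TangentSpace 𝓘(ℝ, E) x)

/-- A magnetic field on `M`: a smooth closed differential form of degree two. -/
structure MagneticField where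
  /-- The value `F x v w` of the form on two tangent vectors at `x`. -/
  form : ∀ x : M, TangentSpace 𝓘(ℝ, E) x →L[ℝ] TangentSpace 𝓘(ℝ, E) x →L[ℝ] ℝ
  alternating : ∀ (x : M) (v : TangentSpace 𝓘(ℝ, E) x), form x v v = 0
  /-- The form is a smooth section of the bundle of bilinear forms on the tangent spaces. -/
  smooth : ContMDiff 𝓘(ℝ, E) (𝓘(ℝ, E).prod 𝓘(ℝ, E →L[ℝ] E →L[ℝ] ℝ)) ∞
    (fun x : M ↦ Bundle.TotalSpace.mk' (E →L[ℝ] E →L[ℝ] ℝ)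
      (E := fun x : M ↦ TangentSpace 𝓘(ℝ, E) x →L[ℝ] TangentSpace 𝓘(ℝ, E) x →L[ℝ] ℝ) x (form x))
  /-- `dF = 0`: in the coordinates of each chart,
  `dF(u, v, w) = ∂_u F(v, w) + ∂_v F(w, u) + ∂_w F(u, v)` vanishes for all `u, v, w`. -/
  closed : ∀ (p : M), ∀ y ∈ (chartAt E p).target, ∀ u v w : E,
    fderiv ℝ (localRep form (chartAt E p)) y u v w
      + fderiv ℝ (localRep form (chartAt E p)) y v w u
      + fderiv ℝ (localRep form (chartAt E p)) y w u v = 0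

end Forms

section Curves

variable {E : Type*} [NormedAddCommGroup E] [NormedSpace ℝ E]
  {M : Type*} [TopologicalSpace M] [ChartedSpace E M] [IsManifold 𝓘(ℝ, E) ∞ M]

/-- The Christoffel symbol `Γ(v, w)` of the Levi-Civita connection of `g` in the chart `e` at the
point with coordinates `y`, that is, the vector with components `Γᵏᵢⱼ vⁱ wʲ`. It is determined by
`G(Γ(v, w), z) = (∂_v G(w, z) + ∂_w G(v, z) - ∂_z G(v, w)) / 2`, where `G` is the matrix of the
metric in the chart; see `localRep_christoffel`. -/
def christoffel (g : RiemMetric E M) (e : OpenPartialHomeomorph M E) (y : E) (v w : E) : E :=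
  (localRep g.inner e y).inverse
    ((1 / 2 : ℝ) • (fderiv ℝ (localRep g.inner e) y v w + fderiv ℝ (localRep g.inner e) y w v
      - ((fderiv ℝ (localRep g.inner e) y).flip v).flip w))

/-- The velocity `γ'(t)`, a tangent vector at `γ t`. -/
def velocity (γ : ℝ → M) (t : ℝ) : TangentSpace 𝓘(ℝ, E) (γ t) :=
  mfderiv 𝓘(ℝ, ℝ) 𝓘(ℝ, E) γ t (1 : ℝ)

/-- The covariant derivative of the velocity along `γ`, that is `∇_{γ'} γ'` at the time `t`, for
the Levi-Civita connection `∇` of `g`: in the coordinates `c = e ∘ γ` of the chart `e` around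
`γ t` it is the vector with components `(cᵏ)'' + Γᵏᵢⱼ (cⁱ)' (cʲ)'`. -/
def acceleration (g : RiemMetric E M) (γ : ℝ → M) (t : ℝ) : TangentSpace 𝓘(ℝ, E) (γ t) :=
  let e := chartAt E (γ t)
  let c : ℝ → E := fun s ↦ e (γ s)
  (mfderiv 𝓘(ℝ, E) 𝓘(ℝ, E) e (γ t)).inverse
    (deriv (deriv c) t + christoffel g e (c t) (deriv c t) (deriv c t))

/-- The Lorentz force `Φ` of `(M, g, F)` at `x`, determined by `g(Φ v, w) = F(v, w)`; see
`inner_lorentzForce`. -/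
def lorentzForce (g : RiemMetric E M) (F : MagneticField E M) (x : M)
    (v : TangentSpace 𝓘(ℝ, E) x) : TangentSpace 𝓘(ℝ, E) x :=
  (g.inner x).inverse (F.form x v)

/-- `J` is the domain of a curve: a non-empty open interval, possibly unbounded. -/
def IsOpenInterval (J : Set ℝ) : Prop :=
  J.Nonempty ∧ IsOpen J ∧ J.OrdConnected

/-- The restriction of `γ` to the open interval `J` is a geodesic of `g`. -/
def IsGeodesic (g : RiemMetric E M) (γ : ℝ → M) (J : Set ℝ) : Prop :=
  IsOpenInterval J ∧ ContMDiffOn 𝓘(ℝ, ℝ) 𝓘(ℝ, E) ∞ γ J ∧ ∀ t ∈ J, acceleration g γ t = 0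

/-- The restriction of `γ` to the open interval `J` is a magnetic curve of `(M, g, F)`: a smooth
curve with `∇_{γ'} γ' = Φ(γ')`. -/
def IsMagneticCurve (g : RiemMetric E M) (F : MagneticField E M) (γ : ℝ → M) (J : Set ℝ) : Prop :=
  IsOpenInterval J ∧ ContMDiffOn 𝓘(ℝ, ℝ) 𝓘(ℝ, E) ∞ γ J ∧
    ∀ t ∈ J, acceleration g γ t = lorentzForce g F (γ t) (velocity γ t)

/-- For a class `P` of curves (a curve is a map together with its domain), the curve `γ` on `J`
belongs to `P` and is not the restriction of a curve of `P` with a larger domain. -/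
def IsInextendible {X : Type*} (P : (ℝ → X) → Set ℝ → Prop) (γ : ℝ → X) (J : Set ℝ) : Prop :=
  P γ J ∧ ∀ (η : ℝ → X) (K : Set ℝ), P η K → J ⊆ K → EqOn η γ J → K = J

/-- `(M, g)` is geodesically complete: all inextendible geodesics are defined on all of `ℝ`. -/
def GeodesicallyComplete (g : RiemMetric E M) : Prop :=
  ∀ (γ : ℝ → M) (J : Set ℝ), IsInextendible (IsGeodesic g) γ J → J = univ

/-! ### The metric inverts, so that the two defining relations above hold -/

theorem isInvertible_of_pos [FiniteDimensional ℝ E] (b : E →L[ℝ] E →L[ℝ] ℝ)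
    (hb : ∀ v, v ≠ 0 → 0 < b v v) : b.IsInvertible := by
  have hinj : Function.Injective b := by
    rw [injective_iff_map_eq_zero]
    intro v hv
    by_contra h
    have := hb v h
    simp [hv] at this
  have hfd : Module.finrank ℝ E = Module.finrank ℝ (E →L[ℝ] ℝ) := by
    rw [← (LinearMap.toContinuousLinearMap (𝕜 := ℝ) (E := E) (F' := ℝ)).finrank_eq]
    exact (Subspace.dual_finrank_eq (K := ℝ) (V := E)).symm
  exact ⟨(LinearEquiv.ofInjectiveOfFinrankEq b.toLinearMap hinj hfd).toContinuousLinearEquiv,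
    by ext; rfl⟩

theorem inner_lorentzForce [FiniteDimensional ℝ E] (g : RiemMetric E M) (F : MagneticField E M)
    (x : M) (v w : TangentSpace 𝓘(ℝ, E) x) :
    g.inner x (lorentzForce g F x v) w = F.form x v w := by
  have h : (g.inner x).IsInvertible := isInvertible_of_pos (E := E) (g.inner x) (g.pos x)
  rw [lorentzForce, h.self_apply_inverse]

theorem localRep_christoffel [FiniteDimensional ℝ E] (g : RiemMetric E M)
    {e : OpenPartialHomeomorph M E} (he : e ∈ IsManifold.maximalAtlas 𝓘(ℝ, E) 1 M)
    {y : E} (hy : y ∈ e.target) (v w z : E) :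
    localRep g.inner e y (christoffel g e y v w) z =
      (1 / 2 : ℝ) * (fderiv ℝ (localRep g.inner e) y v w z
        + fderiv ℝ (localRep g.inner e) y w v z - fderiv ℝ (localRep g.inner e) y z v w) := by
  have hinj : Function.Injective (mfderiv 𝓘(ℝ, E) 𝓘(ℝ, E) e.symm y) := by
    have hme : e.MDifferentiable 𝓘(ℝ, E) 𝓘(ℝ, E) :=
      ⟨fun x hx ↦ (mdifferentiableAt_of_mem_maximalAtlas he hx).mdifferentiableWithinAt,
        fun x hx ↦ (mdifferentiableAt_symm_of_mem_maximalAtlas he hx).mdifferentiableWithinAt⟩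
    exact hme.symm.mfderiv_injective hy
  have h : (localRep g.inner e y).IsInvertible := by
    refine isInvertible_of_pos _ fun v hv ↦ ?_
    rw [localRep_apply]
    refine g.pos _ _ fun h0 ↦ hv (hinj ?_)
    exact h0.trans (map_zero (mfderiv 𝓘(ℝ, E) 𝓘(ℝ, E) e.symm y)).symm
  rw [christoffel, h.self_apply_inverse]
  simp

end Curves

end MagneticCurves

end

/-! A magnetic curve has constant speed, because g(Φ(v), v) = F(v, v) = 0, so it has finite length
over a bounded time. If it stayed in a compact set near a finite end of its domain, its position and
velocity would accumulate there, and the uniform existence time of the equation near the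
accumulation point would carry it past the end (`IsMagneticCurve.exists_extension`). So an
inextendible magnetic curve with a finite end is a curve of finite length that is not eventually
contained in any compact set. Geodesic completeness excludes such curves
(`GeodesicallyComplete.not_escapes`).

The exclusion is the Hopf–Rinow argument applied to the "distance to infinity". Let R(x) be the
infimum of the times in which a curve of speed at most one can escape from x (`escapeTime`); a slow
curve from x to y of duration τ gives R(x) ≤ τ + R(y). Suppose some curve escapes from x. Every
escaping curve crosses a small coordinate sphere around x. By compactness, the length of the short
geodesic from x to y plus R(y) has a minimum on that sphere, and this minimum is at most R(x). Hence
a unit-speed geodesic leaves x along which R has dropped by at least δ after some time δ > 0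
(`GeodesicallyComplete.exists_descent`). The local input is that points near x are joined to x by
geodesics with initial velocity continuous in the endpoint (`exists_connecting_geodesics`), and that
these are shortest among the slow curves in a small ball (`exists_geodesic_minimizing`).

By completeness this geodesic η is defined on ℝ. The times s with s + R(η s) ≤ R(η 0) are bounded,
as R ≥ 0, and their supremum is again such a time. There a second descent starts, along a geodesic
ξ. If ξ left η at an angle, cutting the corner would save time and contradict the definition of R
(`deriv_eq_of_escapeTime`). So ξ continues η, and the supremum is exceeded.

Geodesics are handled throughout as the magnetic curves of the zero field. -/

noncomputable section

namespace MagneticCurves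

set_option linter.unusedSectionVars false
set_option maxSynthPendingDepth 3

/-! ### Charts and the coordinate expressions of tensors -/

section Atlas

variable {E : Type*} [NormedAddCommGroup E] [NormedSpace ℝ E]
  {M : Type*} [TopologicalSpace M] [ChartedSpace E M]

theorem maximalAtlas_one {e : OpenPartialHomeomorph M E}
    (he : e ∈ IsManifold.maximalAtlas 𝓘(ℝ, E) ∞ M) : e ∈ IsManifold.maximalAtlas 𝓘(ℝ, E) 1 M :=
  IsManifold.maximalAtlas_subset_of_le (by simp) he

theorem contDiffOn_transition {e e' : OpenPartialHomeomorph M E}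
    (he : e ∈ IsManifold.maximalAtlas 𝓘(ℝ, E) ∞ M)
    (he' : e' ∈ IsManifold.maximalAtlas 𝓘(ℝ, E) ∞ M) :
    ContDiffOn ℝ ∞ (e' ∘ e.symm) (e.symm ≫ₕ e').source := by
  rw [← contMDiffOn_iff_contDiffOn]
  refine (contMDiffOn_of_mem_maximalAtlas he').comp
    ((contMDiffOn_symm_of_mem_maximalAtlas he).mono fun y hy ↦ ?_) fun y hy ↦ ?_
  · exact (by simpa using hy : y ∈ e.target ∧ _).1
  · exact (by simpa using hy : y ∈ e.target ∧ _).2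

end Atlas

section Charts

variable {E : Type*} [NormedAddCommGroup E] [NormedSpace ℝ E]
  {M : Type*} [TopologicalSpace M] [ChartedSpace E M] [IsManifold 𝓘(ℝ, E) ∞ M]

theorem mdifferentiable_chart_of_mem {e : OpenPartialHomeomorph M E}
    (he : e ∈ IsManifold.maximalAtlas 𝓘(ℝ, E) ∞ M) :
    e.MDifferentiable 𝓘(ℝ, E) 𝓘(ℝ, E) :=
  ⟨fun _ hx ↦ (mdifferentiableAt_of_mem_maximalAtlas
      (maximalAtlas_one he) hx).mdifferentiableWithinAt,
    fun _ hx ↦ (mdifferentiableAt_symm_of_mem_maximalAtlas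
      (maximalAtlas_one he) hx).mdifferentiableWithinAt⟩

theorem contMDiffOn_coordField {e : OpenPartialHomeomorph M E}
    (he : e ∈ IsManifold.maximalAtlas 𝓘(ℝ, E) ∞ M) (v : E) :
    ContMDiffOn 𝓘(ℝ, E) (𝓘(ℝ, E).prod 𝓘(ℝ, E)) ∞
      (fun y ↦ Bundle.TotalSpace.mk' E (E := fun x : M ↦ TangentSpace 𝓘(ℝ, E) x) (e.symm y)
        (mfderiv 𝓘(ℝ, E) 𝓘(ℝ, E) e.symm y v)) e.target := by
  have h := (contMDiffOn_symm_of_mem_maximalAtlas he).contMDiffOn_tangentMapWithin (m := ∞)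
    (by simp) (e.open_target.uniqueMDiffOn)
  have h2 : ContMDiff 𝓘(ℝ, E) (𝓘(ℝ, E).prod 𝓘(ℝ, E)) ∞
      (fun y : E ↦ (⟨y, v⟩ : TangentBundle 𝓘(ℝ, E) E)) := by
    exact contMDiff_vectorSpace_iff_contDiff.2 contDiff_const
  refine (h.comp h2.contMDiffOn (s := e.target) (fun y hy ↦ hy)).congr fun y hy ↦ ?_
  simp [tangentMapWithin, mfderivWithin_of_isOpen e.open_target hy]

/-- In finite dimension smoothness can be tested on pairs of constant vectors, whose images under
the inverse chart are smooth sections (`contMDiffOn_coordField`). -/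
theorem contDiffOn_localRep [FiniteDimensional ℝ E]
    {b : ∀ x : M, TangentSpace 𝓘(ℝ, E) x →L[ℝ] TangentSpace 𝓘(ℝ, E) x →L[ℝ] ℝ}
    (hb : ContMDiff 𝓘(ℝ, E) (𝓘(ℝ, E).prod 𝓘(ℝ, E →L[ℝ] E →L[ℝ] ℝ)) ∞
      (fun x : M ↦ Bundle.TotalSpace.mk' (E →L[ℝ] E →L[ℝ] ℝ)
      (E := fun x : M ↦ TangentSpace 𝓘(ℝ, E) x →L[ℝ] TangentSpace 𝓘(ℝ, E) x →L[ℝ] ℝ) x (b x)))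
    {e : OpenPartialHomeomorph M E} (he : e ∈ IsManifold.maximalAtlas 𝓘(ℝ, E) ∞ M) :
    ContDiffOn ℝ ∞ (localRep b e) e.target := by
  rw [contDiffOn_clm_apply]
  intro v
  rw [contDiffOn_clm_apply]
  intro w
  rw [← contMDiffOn_iff_contDiffOn]
  have : ContMDiffOn 𝓘(ℝ, E) (𝓘(ℝ, E).prod 𝓘(ℝ)) ∞
      (fun y ↦ Bundle.TotalSpace.mk' ℝ (E := Bundle.Trivial M ℝ) (e.symm y)
        (b (e.symm y) (mfderiv 𝓘(ℝ, E) 𝓘(ℝ, E) e.symm y v)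
        (mfderiv 𝓘(ℝ, E) 𝓘(ℝ, E) e.symm y w))) e.target := by
    apply ContMDiffOn.clm_bundle_apply₂ (F₁ := E) (F₂ := E)
    · exact hb.comp_contMDiffOn (contMDiffOn_symm_of_mem_maximalAtlas he)
    · exact contMDiffOn_coordField he v
    · exact contMDiffOn_coordField he w
  intro y hy
  have h2 := this y hy
  simp only [Bundle.contMDiffWithinAt_totalSpace] at h2
  exact h2.2

theorem localRep_comp
    (b : ∀ x : M, TangentSpace 𝓘(ℝ, E) x →L[ℝ] TangentSpace 𝓘(ℝ, E) x →L[ℝ] ℝ)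
    {e e' : OpenPartialHomeomorph M E} (he : e ∈ IsManifold.maximalAtlas 𝓘(ℝ, E) ∞ M)
    (he' : e' ∈ IsManifold.maximalAtlas 𝓘(ℝ, E) ∞ M) {y : E} (hy : y ∈ (e.symm ≫ₕ e').source)
    (v w : E) :
    localRep b e y v w = localRep b e' (e' (e.symm y)) (fderiv ℝ (e' ∘ e.symm) y v)
      (fderiv ℝ (e' ∘ e.symm) y w) := by
  have hy' : y ∈ e.target ∧ e.symm y ∈ e'.source := by simpa using hy
  have h1 : mfderiv 𝓘(ℝ, E) 𝓘(ℝ, E) (e' ∘ e.symm) y = _ :=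
    mfderiv_comp y ((mdifferentiable_chart_of_mem he').mdifferentiableAt hy'.2)
      ((mdifferentiable_chart_of_mem he).mdifferentiableAt_symm hy'.1)
  have h2 := (mdifferentiable_chart_of_mem he').symm_comp_deriv hy'.2
  have h3 (u : E) : mfderiv 𝓘(ℝ, E) 𝓘(ℝ, E) e'.symm (e' (e.symm y))
      (fderiv ℝ (e' ∘ e.symm) y u) = mfderiv 𝓘(ℝ, E) 𝓘(ℝ, E) e.symm y u := by
    rw [← mfderiv_eq_fderiv, h1]
    exact congrArg (fun L ↦ L (mfderiv 𝓘(ℝ, E) 𝓘(ℝ, E) e.symm y u)) h2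
  rw [localRep_apply, localRep_apply]
  simp only [h3]
  rw [e'.left_inv hy'.2]

end Charts

/-! ### Chain rules for a change of coordinates -/

section Transformation

variable {E : Type*} [NormedAddCommGroup E] [NormedSpace ℝ E]

/-- The terms with the second derivative of `τ` are the source of the inhomogeneous term in the
transformation law of the Christoffel symbols. -/
theorem fderiv_pullback_bilin {G G' : E → E →L[ℝ] E →L[ℝ] ℝ} {τ : E → E} {y : E}
    (hG : DifferentiableAt ℝ G y) (hG' : DifferentiableAt ℝ G' (τ y)) (hτ : ContDiffAt ℝ 2 τ y)
    (h : ∀ᶠ z in 𝓝 y, ∀ v w, G z v w = G' (τ z) (fderiv ℝ τ z v) (fderiv ℝ τ z w)) (u v w : E) :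
    fderiv ℝ G y u v w =
      fderiv ℝ G' (τ y) (fderiv ℝ τ y u) (fderiv ℝ τ y v) (fderiv ℝ τ y w)
      + G' (τ y) (fderiv ℝ (fderiv ℝ τ) y u v) (fderiv ℝ τ y w)
      + G' (τ y) (fderiv ℝ τ y v) (fderiv ℝ (fderiv ℝ τ) y u w) := by
  have hτ1 : HasFDerivAt τ (fderiv ℝ τ y) y := (hτ.differentiableAt (by simp)).hasFDerivAt
  have hτ2 : HasFDerivAt (fderiv ℝ τ) (fderiv ℝ (fderiv ℝ τ) y) y :=
    ((hτ.fderiv_right (m := 1) (by norm_num)).differentiableAt (by simp)).hasFDerivAt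
  have h1 : HasFDerivAt (fun z ↦ G z v w) _ y :=
    (hG.hasFDerivAt.clm_apply (hasFDerivAt_const v y)).clm_apply (hasFDerivAt_const w y)
  have h2 : HasFDerivAt (fun z ↦ G' (τ z) (fderiv ℝ τ z v) (fderiv ℝ τ z w)) _ y :=
    ((hG'.hasFDerivAt.comp y hτ1).clm_apply
      (hτ2.clm_apply (hasFDerivAt_const v y))).clm_apply (hτ2.clm_apply (hasFDerivAt_const w y))
  have h3 := h1.unique (h2.congr_of_eventuallyEq (h.mono fun z hz ↦ hz v w))
  have h4 := congrArg (fun L ↦ L u) h3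
  simp at h4
  rw [h4]
  ring

theorem contDiffAt_deriv {c : ℝ → E} {t : ℝ} (hc : ContDiffAt ℝ ∞ c t) :
    ContDiffAt ℝ ∞ (deriv c) t := by
  simpa only [fderiv_apply_one_eq_deriv] using
    (hc.fderiv_right (m := ∞) (by simp)).clm_apply (contDiffAt_const (c := (1 : ℝ)))

theorem deriv_comp_of_contDiffAt {τ : E → E} {c : ℝ → E} {t : ℝ}
    (hτ : ContDiffAt ℝ ∞ τ (c t)) (hc : ContDiffAt ℝ ∞ c t) :
    deriv (fun s ↦ τ (c s)) t = fderiv ℝ τ (c t) (deriv c t) :=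
  ((hτ.differentiableAt (by simp)).hasFDerivAt.comp_hasDerivAt t
    (hc.differentiableAt (by simp)).hasDerivAt).deriv

theorem deriv_deriv_comp_of_contDiffAt {τ : E → E} {c : ℝ → E} {t : ℝ}
    (hτ : ContDiffAt ℝ ∞ τ (c t)) (hc : ContDiffAt ℝ ∞ c t) :
    deriv (deriv fun s ↦ τ (c s)) t =
      fderiv ℝ (fderiv ℝ τ) (c t) (deriv c t) (deriv c t)
        + fderiv ℝ τ (c t) (deriv (deriv c) t) := by
  have hτev : ∀ᶠ s in 𝓝 t, ContDiffAt ℝ 1 τ (c s) :=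
    hc.continuousAt.eventually ((hτ.of_le (by norm_cast)).eventually (by simp))
  have hcev : ∀ᶠ s in 𝓝 t, ContDiffAt ℝ 1 c s := (hc.of_le (by norm_cast)).eventually (by simp)
  have h2 : deriv (fun s ↦ τ (c s)) =ᶠ[𝓝 t] fun s ↦ fderiv ℝ τ (c s) (deriv c s) := by
    filter_upwards [hτev, hcev] with s hτs hcs
    exact ((hτs.differentiableAt (by simp)).hasFDerivAt.comp_hasDerivAt s
      (hcs.differentiableAt (by simp)).hasDerivAt).deriv
  have hτ2 : HasFDerivAt (fderiv ℝ τ) (fderiv ℝ (fderiv ℝ τ) (c t)) (c t) :=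
    ((hτ.fderiv_right (m := ∞) (by simp)).differentiableAt (by simp)).hasFDerivAt
  have hc2 : HasDerivAt (deriv c) (deriv (deriv c) t) t :=
    ((contDiffAt_deriv hc).differentiableAt (by simp)).hasDerivAt
  have hc1 : HasDerivAt c (deriv c t) t := (hc.differentiableAt (by simp)).hasDerivAt
  exact h2.deriv_eq.trans ((hτ2.comp_hasDerivAt t hc1).clm_apply hc2).deriv

end Transformation

/-! ### Independence of the acceleration and the Lorentz force from the chart -/

section Curves

variable {E : Type*} [NormedAddCommGroup E] [NormedSpace ℝ E] [FiniteDimensional ℝ E]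
  {M : Type*} [TopologicalSpace M] [ChartedSpace E M] [IsManifold 𝓘(ℝ, E) ∞ M]
  {g : RiemMetric E M}

/-- The differential of the chart `e` at `x`: the coordinates of a tangent vector. -/
def chartDeriv (e : OpenPartialHomeomorph M E) (x : M) : TangentSpace 𝓘(ℝ, E) x →L[ℝ] E :=
  mfderiv 𝓘(ℝ, E) 𝓘(ℝ, E) e x

theorem mfderiv_symm_chartDeriv {e : OpenPartialHomeomorph M E}
    (he : e ∈ IsManifold.maximalAtlas 𝓘(ℝ, E) ∞ M) {x : M} (hx : x ∈ e.source)
    (v : TangentSpace 𝓘(ℝ, E) x) :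
    mfderiv 𝓘(ℝ, E) 𝓘(ℝ, E) e.symm (e x) (chartDeriv e x v) = v :=
  congrArg (fun L ↦ L v) ((mdifferentiable_chart_of_mem he).symm_comp_deriv hx)

theorem chartDeriv_bijective {e : OpenPartialHomeomorph M E}
    (he : e ∈ IsManifold.maximalAtlas 𝓘(ℝ, E) ∞ M) {x : M} (hx : x ∈ e.source) :
    Function.Bijective (chartDeriv e x) :=
  (mdifferentiable_chart_of_mem he).mfderiv_bijective hx

theorem localRep_chartDeriv
    (b : ∀ x : M, TangentSpace 𝓘(ℝ, E) x →L[ℝ] TangentSpace 𝓘(ℝ, E) x →L[ℝ] ℝ)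
    {e : OpenPartialHomeomorph M E} (he : e ∈ IsManifold.maximalAtlas 𝓘(ℝ, E) ∞ M) {x : M}
    (hx : x ∈ e.source) (v w : TangentSpace 𝓘(ℝ, E) x) :
    localRep b e (e x) (chartDeriv e x v) (chartDeriv e x w) = b x v w := by
  rw [localRep_apply]
  simp only [mfderiv_symm_chartDeriv he hx]
  rw [e.left_inv hx]

theorem chartDeriv_transition {e e' : OpenPartialHomeomorph M E}
    (he : e ∈ IsManifold.maximalAtlas 𝓘(ℝ, E) ∞ M)
    (he' : e' ∈ IsManifold.maximalAtlas 𝓘(ℝ, E) ∞ M) {x : M} (hx : x ∈ e.source)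
    (hx' : x ∈ e'.source) (v : TangentSpace 𝓘(ℝ, E) x) :
    chartDeriv e' x v = fderiv ℝ (e' ∘ e.symm) (e x) (chartDeriv e x v) := by
  have hxs : e.symm (e x) ∈ e'.source := by rwa [e.left_inv hx]
  have h1 : mfderiv 𝓘(ℝ, E) 𝓘(ℝ, E) (e' ∘ e.symm) (e x) = _ :=
    mfderiv_comp (e x) ((mdifferentiable_chart_of_mem he').mdifferentiableAt hxs)
      ((mdifferentiable_chart_of_mem he).mdifferentiableAt_symm (e.map_source hx))
  rw [← mfderiv_eq_fderiv, h1]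
  change _ = mfderiv 𝓘(ℝ, E) 𝓘(ℝ, E) e' (e.symm (e x))
    (mfderiv 𝓘(ℝ, E) 𝓘(ℝ, E) e.symm (e x) (chartDeriv e x v))
  rw [mfderiv_symm_chartDeriv he hx, e.left_inv hx]
  rfl

theorem localRep_inner_symm (g : RiemMetric E M) (e : OpenPartialHomeomorph M E) (y v w : E) :
    localRep g.inner e y v w = localRep g.inner e y w v := by
  rw [localRep_apply, localRep_apply, g.symm]

theorem localRep_inner_pos (g : RiemMetric E M) {e : OpenPartialHomeomorph M E}
    (he : e ∈ IsManifold.maximalAtlas 𝓘(ℝ, E) ∞ M) {y : E} (hy : y ∈ e.target) {v : E}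
    (hv : v ≠ 0) : 0 < localRep g.inner e y v v := by
  rw [localRep_apply]
  refine g.pos _ _ fun h0 ↦ hv ((mdifferentiable_chart_of_mem he).symm.mfderiv_injective hy ?_)
  exact h0.trans (map_zero (mfderiv 𝓘(ℝ, E) 𝓘(ℝ, E) e.symm y)).symm

theorem contDiffOn_localRep_inner (g : RiemMetric E M) {e : OpenPartialHomeomorph M E}
    (he : e ∈ IsManifold.maximalAtlas 𝓘(ℝ, E) ∞ M) :
    ContDiffOn ℝ ∞ (localRep g.inner e) e.target :=
  contDiffOn_localRep g.contMDiff he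

theorem eq_of_forall_localRep_inner (g : RiemMetric E M) {e : OpenPartialHomeomorph M E}
    (he : e ∈ IsManifold.maximalAtlas 𝓘(ℝ, E) ∞ M) {y : E} (hy : y ∈ e.target) {v w : E}
    (h : ∀ z, localRep g.inner e y v z = localRep g.inner e y w z) : v = w := by
  by_contra hne
  have := localRep_inner_pos g he hy (sub_ne_zero.2 hne)
  simp only [map_sub, sub_apply, h] at this
  simp at this

/-- The metric is nondegenerate, so the identity may be tested against vectors Dτ z. In the Koszul
combination of the derivatives of the pulled-back metric, the symmetry of D²τ makes all second-order
terms cancel except the pairing of D²τ(v, w) with Dτ z. -/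
theorem christoffel_transition (g : RiemMetric E M) {e e' : OpenPartialHomeomorph M E}
    (he : e ∈ IsManifold.maximalAtlas 𝓘(ℝ, E) ∞ M)
    (he' : e' ∈ IsManifold.maximalAtlas 𝓘(ℝ, E) ∞ M) {y : E} (hy : y ∈ (e.symm ≫ₕ e').source)
    (v w : E) :
    christoffel g e' (e' (e.symm y)) (fderiv ℝ (e' ∘ e.symm) y v) (fderiv ℝ (e' ∘ e.symm) y w)
      + fderiv ℝ (fderiv ℝ (e' ∘ e.symm)) y v w
      = fderiv ℝ (e' ∘ e.symm) y (christoffel g e y v w) := by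
  have hy' : y ∈ e.target ∧ e.symm y ∈ e'.source := by simpa using hy
  have hyt : e' (e.symm y) ∈ e'.target := e'.map_source hy'.2
  have hn : (e.symm ≫ₕ e').source ∈ 𝓝 y := (e.symm ≫ₕ e').open_source.mem_nhds hy
  have hτ : ContDiffAt ℝ ∞ (e' ∘ e.symm) y := (contDiffOn_transition he he').contDiffAt hn
  have hτ2 : ContDiffAt ℝ 2 (e' ∘ e.symm) y := hτ.of_le (by norm_cast)
  have hG : DifferentiableAt ℝ (localRep g.inner e) y :=
    ((contDiffOn_localRep_inner g he).contDiffAt (e.open_target.mem_nhds hy'.1)).differentiableAt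
      (by simp)
  have hG' : DifferentiableAt ℝ (localRep g.inner e') ((e' ∘ e.symm) y) :=
    ((contDiffOn_localRep_inner g he').contDiffAt (e'.open_target.mem_nhds hyt)).differentiableAt
      (by simp)
  have key := fderiv_pullback_bilin hG hG' hτ2
    (eventually_of_mem hn fun z hz v w ↦ localRep_comp g.inner he he' hz v w)
  have hsymm (a b : E) : fderiv ℝ (fderiv ℝ (e' ∘ e.symm)) y a b =
      fderiv ℝ (fderiv ℝ (e' ∘ e.symm)) y b a :=
    (hτ2.isSymmSndFDerivAt (by simp)) a b
  have hsurj : Function.Surjective (fderiv ℝ (e' ∘ e.symm) y) := by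
    have h1 : mfderiv 𝓘(ℝ, E) 𝓘(ℝ, E) (e' ∘ e.symm) y = _ :=
      mfderiv_comp y ((mdifferentiable_chart_of_mem he').mdifferentiableAt hy'.2)
        ((mdifferentiable_chart_of_mem he).mdifferentiableAt_symm hy'.1)
    rw [← mfderiv_eq_fderiv, h1]
    exact ((mdifferentiable_chart_of_mem he').mfderiv_surjective hy'.2).comp
      ((mdifferentiable_chart_of_mem he).symm.mfderiv_surjective hy'.1)
  refine eq_of_forall_localRep_inner g he' hyt fun z' ↦ ?_
  obtain ⟨z, rfl⟩ := hsurj z'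
  rw [map_add, add_apply, localRep_christoffel g (maximalAtlas_one he') hyt,
    ← localRep_comp g.inner he he' hy, localRep_christoffel g (maximalAtlas_one he) hy'.1,
    key, key, key, hsymm w v, hsymm z v, hsymm z w]
  simp only [Function.comp_apply]
  have s1 (a b : E) := localRep_inner_symm g e' (e' (e.symm y)) a b
  rw [s1 (fderiv ℝ (e' ∘ e.symm) y v) (fderiv ℝ (fderiv ℝ (e' ∘ e.symm)) y w z),
    s1 (fderiv ℝ (e' ∘ e.symm) y w) (fderiv ℝ (fderiv ℝ (e' ∘ e.symm)) y v z)]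
  ring

theorem chartDeriv_velocity {e : OpenPartialHomeomorph M E}
    (he : e ∈ IsManifold.maximalAtlas 𝓘(ℝ, E) ∞ M) {γ : ℝ → M} {t : ℝ}
    (hγ : MDifferentiableAt 𝓘(ℝ, ℝ) 𝓘(ℝ, E) γ t) (ht : γ t ∈ e.source) :
    HasDerivAt (fun s ↦ e (γ s)) (chartDeriv e (γ t) (velocity γ t)) t := by
  have h : HasFDerivAt (fun s ↦ e (γ s)) (_ : ℝ →L[ℝ] E) t := hasMFDerivAt_iff_hasFDerivAt.1
    (((mdifferentiable_chart_of_mem he).mdifferentiableAt ht).hasMFDerivAt.comp t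
      hγ.hasMFDerivAt)
  exact h.hasDerivAt

/-- `acceleration` is defined in the chart at `γ t`, which varies with `t`; this permits one fixed
chart along a piece of the curve. The second derivative of the transition map produced by the chain
rule is the one absorbed by `christoffel_transition`. -/
theorem chartDeriv_acceleration (g : RiemMetric E M) {e : OpenPartialHomeomorph M E}
    (he : e ∈ IsManifold.maximalAtlas 𝓘(ℝ, E) ∞ M) {γ : ℝ → M} {t : ℝ}
    (hγ : ContMDiffAt 𝓘(ℝ, ℝ) 𝓘(ℝ, E) ∞ γ t) (ht : γ t ∈ e.source) :
    chartDeriv e (γ t) (acceleration g γ t) =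
      deriv (deriv fun s ↦ e (γ s)) t + christoffel g e (e (γ t))
        (deriv (fun s ↦ e (γ s)) t) (deriv (fun s ↦ e (γ s)) t) := by
  set e₀ := chartAt E (γ t) with he₀_def
  have he₀ : e₀ ∈ IsManifold.maximalAtlas 𝓘(ℝ, E) ∞ M :=
    IsManifold.chart_mem_maximalAtlas (γ t)
  have ht₀ : γ t ∈ e₀.source := mem_chart_source E (γ t)
  have h0 : chartDeriv e₀ (γ t) (acceleration g γ t) =
      deriv (deriv fun s ↦ e₀ (γ s)) t + christoffel g e₀ (e₀ (γ t))
        (deriv (fun s ↦ e₀ (γ s)) t) (deriv (fun s ↦ e₀ (γ s)) t) := by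
    have hinv : (mfderiv 𝓘(ℝ, E) 𝓘(ℝ, E) e₀ (γ t)).IsInvertible :=
      ⟨(mdifferentiable_chart_of_mem he₀).mfderiv ht₀, rfl⟩
    exact hinv.self_apply_inverse _
  have hy : e₀ (γ t) ∈ (e₀.symm ≫ₕ e).source := by
    simp [e₀.map_source ht₀, e₀.left_inv ht₀, ht]
  have hτ : ContDiffAt ℝ ∞ (e ∘ e₀.symm) (e₀ (γ t)) :=
    (contDiffOn_transition he₀ he).contDiffAt ((e₀.symm ≫ₕ e).open_source.mem_nhds hy)
  have hc : ContDiffAt ℝ ∞ (fun s ↦ e₀ (γ s)) t := by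
    rw [← contMDiffAt_iff_contDiffAt]
    exact (contMDiffAt_of_mem_maximalAtlas he₀ ht₀).comp t hγ
  have hcont : ContinuousAt γ t := hγ.continuousAt
  have hev : ∀ᶠ s in 𝓝 t, γ s ∈ e₀.source := hcont.eventually (e₀.open_source.mem_nhds ht₀)
  have h1 : (fun s ↦ e (γ s)) =ᶠ[𝓝 t] fun s ↦ (e ∘ e₀.symm) (e₀ (γ s)) :=
    hev.mono fun s hs ↦ by simp [e₀.left_inv hs]
  have h2 := h1.deriv_eq.trans (deriv_comp_of_contDiffAt hτ hc)
  have h3 := h1.deriv.deriv_eq.trans (deriv_deriv_comp_of_contDiffAt hτ hc)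
  rw [chartDeriv_transition he₀ he ht₀ ht, h0, map_add, ← christoffel_transition g he₀ he hy, h3,
    h2, e₀.left_inv ht₀]
  abel

theorem chartDeriv_lorentzForce (g : RiemMetric E M) (F : MagneticField E M)
    {e : OpenPartialHomeomorph M E} (he : e ∈ IsManifold.maximalAtlas 𝓘(ℝ, E) ∞ M) {x : M}
    (hx : x ∈ e.source) (v : TangentSpace 𝓘(ℝ, E) x) (z : E) :
    localRep g.inner e (e x) (chartDeriv e x (lorentzForce g F x v)) z =
      localRep F.form e (e x) (chartDeriv e x v) z := by
  obtain ⟨w, rfl⟩ := (chartDeriv_bijective he hx).2 z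
  rw [localRep_chartDeriv _ he hx, localRep_chartDeriv _ he hx, inner_lorentzForce]

end Curves

/-! ### The equation of magnetic curves as an ordinary differential equation -/

section Equation

variable {E : Type*} [NormedAddCommGroup E] [NormedSpace ℝ E] [FiniteDimensional ℝ E]
  {M : Type*} [TopologicalSpace M] [ChartedSpace E M] [IsManifold 𝓘(ℝ, E) ∞ M]

/-- The Christoffel symbol as a continuous bilinear map. -/
def christoffelL (g : RiemMetric E M) (e : OpenPartialHomeomorph M E) (y : E) : E →L[ℝ] E →L[ℝ] E :=
  (ContinuousLinearMap.compL ℝ E (E →L[ℝ] ℝ) E (localRep g.inner e y).inverse) ∘L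
    ((1 / 2 : ℝ) • (fderiv ℝ (localRep g.inner e) y + (fderiv ℝ (localRep g.inner e) y).flip
      - (ContinuousLinearMap.flipₗᵢ ℝ E E ℝ : (E →L[ℝ] E →L[ℝ] ℝ) →L[ℝ] (E →L[ℝ] E →L[ℝ] ℝ)) ∘L
          (fderiv ℝ (localRep g.inner e) y).flip))

theorem christoffelL_apply (g : RiemMetric E M) (e : OpenPartialHomeomorph M E) (y v w : E) :
    christoffelL g e y v w = christoffel g e y v w := by
  rfl

theorem localRep_inner_isInvertible (g : RiemMetric E M) {e : OpenPartialHomeomorph M E}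
    (he : e ∈ IsManifold.maximalAtlas 𝓘(ℝ, E) ∞ M) {y : E} (hy : y ∈ e.target) :
    (localRep g.inner e y).IsInvertible :=
  isInvertible_of_pos _ fun _ hv ↦ localRep_inner_pos g he hy hv

theorem contDiffOn_localRep_inverse (g : RiemMetric E M) {e : OpenPartialHomeomorph M E}
    (he : e ∈ IsManifold.maximalAtlas 𝓘(ℝ, E) ∞ M) :
    ContDiffOn ℝ ∞ (fun y ↦ (localRep g.inner e y).inverse) e.target := by
  intro y hy
  obtain ⟨A, hA⟩ := localRep_inner_isInvertible g he hy
  have h := contDiffAt_map_inverse (n := ∞) A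
  rw [hA] at h
  exact h.comp_contDiffWithinAt y (contDiffOn_localRep_inner g he y hy)

theorem contDiffOn_christoffelL (g : RiemMetric E M) {e : OpenPartialHomeomorph M E}
    (he : e ∈ IsManifold.maximalAtlas 𝓘(ℝ, E) ∞ M) :
    ContDiffOn ℝ ∞ (christoffelL g e) e.target := by
  have h1 : ContDiffOn ℝ ∞ (fderiv ℝ (localRep g.inner e)) e.target :=
    (contDiffOn_localRep_inner g he).fderiv_of_isOpen e.open_target (by simp)
  have h2 : ContDiffOn ℝ ∞ (fun y ↦ (fderiv ℝ (localRep g.inner e) y).flip) e.target :=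
    (ContinuousLinearMap.flipₗᵢ ℝ E E (E →L[ℝ] ℝ)).contDiff.comp_contDiffOn h1
  exact ContDiffOn.clm_comp
    ((ContinuousLinearMap.compL ℝ E (E →L[ℝ] ℝ) E).contDiff.comp_contDiffOn
      (contDiffOn_localRep_inverse g he))
    (((h1.add h2).sub (contDiffOn_const.clm_comp h2)).const_smul (1 / 2 : ℝ))

/-- The second derivative prescribed, at the point `p.1` with the velocity `p.2`, by the equation
of magnetic curves in the coordinates of `e`. -/
def coordForce (g : RiemMetric E M) (F : MagneticField E M) (e : OpenPartialHomeomorph M E)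
    (p : E × E) : E :=
  (localRep g.inner e p.1).inverse (localRep F.form e p.1 p.2) - christoffelL g e p.1 p.2 p.2

theorem contDiffOn_coordForce (g : RiemMetric E M) (F : MagneticField E M)
    {e : OpenPartialHomeomorph M E} (he : e ∈ IsManifold.maximalAtlas 𝓘(ℝ, E) ∞ M) :
    ContDiffOn ℝ ∞ (coordForce g F e) (e.target ×ˢ univ) := by
  have hf : ContDiffOn ℝ ∞ (Prod.fst : E × E → E) (e.target ×ˢ univ) := contDiff_fst.contDiffOn
  have hs : ContDiffOn ℝ ∞ (Prod.snd : E × E → E) (e.target ×ˢ univ) := contDiff_snd.contDiffOn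
  have hm : MapsTo (Prod.fst : E × E → E) (e.target ×ˢ univ) e.target := fun p hp ↦ hp.1
  exact (((contDiffOn_localRep_inverse g he).comp hf hm).clm_apply
    (((contDiffOn_localRep F.smooth he).comp hf hm).clm_apply hs)).sub
    ((((contDiffOn_christoffelL g he).comp hf hm).clm_apply hs).clm_apply hs)

theorem acceleration_eq_lorentzForce_iff (g : RiemMetric E M) (F : MagneticField E M)
    {e : OpenPartialHomeomorph M E} (he : e ∈ IsManifold.maximalAtlas 𝓘(ℝ, E) ∞ M)
    {γ : ℝ → M} {t : ℝ} (hγ : ContMDiffAt 𝓘(ℝ, ℝ) 𝓘(ℝ, E) ∞ γ t) (ht : γ t ∈ e.source) :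
    acceleration g γ t = lorentzForce g F (γ t) (velocity γ t) ↔
      deriv (deriv fun s ↦ e (γ s)) t =
        coordForce g F e (e (γ t), deriv (fun s ↦ e (γ s)) t) := by
  have hv := (chartDeriv_velocity he (hγ.mdifferentiableAt (by simp)) ht).deriv
  have hL : chartDeriv e (γ t) (lorentzForce g F (γ t) (velocity γ t)) =
      (localRep g.inner e (e (γ t))).inverse
        (localRep F.form e (e (γ t)) (deriv (fun s ↦ e (γ s)) t)) := by
    refine eq_of_forall_localRep_inner g he (e.map_source ht) fun z ↦ ?_
    rw [chartDeriv_lorentzForce g F he ht, hv,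
      (localRep_inner_isInvertible g he (e.map_source ht)).self_apply_inverse]
  rw [← (chartDeriv_bijective he ht).1.eq_iff, hL, chartDeriv_acceleration g he hγ ht, coordForce,
    christoffelL_apply, eq_sub_iff_add_eq]

/-- Bootstrapping: if the pair (c, w) is of class Cⁿ, so is its derivative (w, X(c, w)), and the
pair is of class Cⁿ⁺¹. -/
theorem contDiffOn_of_hasDerivAt_pair {I : Set ℝ} (hI : IsOpen I) {U : Set E} {X : E × E → E}
    (hX : ContDiffOn ℝ ∞ X (U ×ˢ univ)) {c w : ℝ → E} (hc : ∀ t ∈ I, HasDerivAt c (w t) t)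
    (hw : ∀ t ∈ I, HasDerivAt w (X (c t, w t)) t) (hcU : ∀ t ∈ I, c t ∈ U) :
    ContDiffOn ℝ ∞ c I := by
  have key : ∀ n : ℕ, ContDiffOn ℝ n (fun t ↦ (c t, w t)) I := by
    intro n
    induction n with
    | zero =>
      rw [Nat.cast_zero, contDiffOn_zero]
      exact fun t ht ↦ ((hc t ht).continuousAt.prodMk (hw t ht).continuousAt).continuousWithinAt
    | succ n ih =>
      have hd (t : ℝ) (ht : t ∈ I) :
          HasDerivAt (fun t ↦ (c t, w t)) (w t, X (c t, w t)) t := (hc t ht).prodMk (hw t ht)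
      rw [Nat.cast_succ, contDiffOn_succ_iff_deriv_of_isOpen hI]
      refine ⟨fun t ht ↦ (hd t ht).differentiableAt.differentiableWithinAt, by simp, ?_⟩
      have h : ContDiffOn ℝ n (fun t ↦ (w t, X (c t, w t))) I :=
        (contDiff_snd.comp_contDiffOn ih).prodMk
          ((hX.of_le (by exact_mod_cast le_top)).comp ih fun t ht ↦ ⟨hcU t ht, mem_univ _⟩)
      exact h.congr fun t ht ↦ (hd t ht).deriv
  exact contDiff_fst.comp_contDiffOn (contDiffOn_infty.2 key)

theorem isMagneticCurve_symm_comp (g : RiemMetric E M) (F : MagneticField E M)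
    {e : OpenPartialHomeomorph M E} (he : e ∈ IsManifold.maximalAtlas 𝓘(ℝ, E) ∞ M)
    {I : Set ℝ} (hI : IsOpenInterval I) {c w : ℝ → E} (hc : ∀ t ∈ I, HasDerivAt c (w t) t)
    (hw : ∀ t ∈ I, HasDerivAt w (coordForce g F e (c t, w t)) t) (hcU : ∀ t ∈ I, c t ∈ e.target) :
    IsMagneticCurve g F (fun t ↦ e.symm (c t)) I := by
  have hs : ContMDiffOn 𝓘(ℝ, ℝ) 𝓘(ℝ, E) ∞ (fun t ↦ e.symm (c t)) I :=
    (contMDiffOn_symm_of_mem_maximalAtlas he).comp (contMDiffOn_iff_contDiffOn.2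
      (contDiffOn_of_hasDerivAt_pair hI.2.1 (contDiffOn_coordForce g F he) hc hw hcU)) hcU
  refine ⟨hI, hs, fun t ht ↦ ?_⟩
  have htI : I ∈ 𝓝 t := hI.2.1.mem_nhds ht
  rw [acceleration_eq_lorentzForce_iff g F he (hs.contMDiffAt htI) (e.map_target (hcU t ht))]
  have h1 : (fun s ↦ e (e.symm (c s))) =ᶠ[𝓝 t] c :=
    eventually_of_mem htI fun s hs ↦ e.right_inv (hcU s hs)
  have h2 : deriv c =ᶠ[𝓝 t] w := eventually_of_mem htI fun s hs ↦ (hc s hs).deriv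
  rw [h1.deriv.deriv_eq, h1.deriv_eq, e.right_inv (hcU t ht), h2.deriv_eq, (hc t ht).deriv,
    (hw t ht).deriv]

namespace IsMagneticCurve

variable {g : RiemMetric E M} {F : MagneticField E M} {γ : ℝ → M} {J : Set ℝ}

theorem contMDiffAt (h : IsMagneticCurve g F γ J) {t : ℝ} (ht : t ∈ J) :
    ContMDiffAt 𝓘(ℝ, ℝ) 𝓘(ℝ, E) ∞ γ t :=
  h.2.1.contMDiffAt (h.1.2.1.mem_nhds ht)

theorem hasDerivAt_coord (h : IsMagneticCurve g F γ J) {e : OpenPartialHomeomorph M E}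
    (he : e ∈ IsManifold.maximalAtlas 𝓘(ℝ, E) ∞ M) {t : ℝ} (ht : t ∈ J) (hs : γ t ∈ e.source) :
    HasDerivAt (fun s ↦ (e (γ s), deriv (fun s ↦ e (γ s)) s))
      (deriv (fun s ↦ e (γ s)) t,
        coordForce g F e (e (γ t), deriv (fun s ↦ e (γ s)) t)) t := by
  have hc : ContDiffAt ℝ ∞ (fun s ↦ e (γ s)) t :=
    contMDiffAt_iff_contDiffAt.1 ((contMDiffAt_of_mem_maximalAtlas he hs).comp t
      (h.contMDiffAt ht))
  rw [← (acceleration_eq_lorentzForce_iff g F he (h.contMDiffAt ht) hs).1 (h.2.2 t ht)]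
  exact (hc.differentiableAt (by simp)).hasDerivAt.prodMk
    ((contDiffAt_deriv hc).differentiableAt (by simp)).hasDerivAt

theorem mono (h : IsMagneticCurve g F γ J) {K : Set ℝ} (hK : IsOpenInterval K) (hKJ : K ⊆ J) :
    IsMagneticCurve g F γ K :=
  ⟨hK, h.2.1.mono hKJ, fun t ht ↦ h.2.2 t (hKJ ht)⟩

end IsMagneticCurve

theorem acceleration_eq_lorentzForce_congr (g : RiemMetric E M) (F : MagneticField E M)
    {γ η : ℝ → M} {t : ℝ} (h : γ =ᶠ[𝓝 t] η) (hγ : ContMDiffAt 𝓘(ℝ, ℝ) 𝓘(ℝ, E) ∞ γ t)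
    (hm : acceleration g γ t = lorentzForce g F (γ t) (velocity γ t)) :
    acceleration g η t = lorentzForce g F (η t) (velocity η t) := by
  have he : chartAt E (γ t) ∈ IsManifold.maximalAtlas 𝓘(ℝ, E) ∞ M :=
    IsManifold.chart_mem_maximalAtlas (γ t)
  have hs : γ t ∈ (chartAt E (γ t)).source := mem_chart_source E (γ t)
  have h1 : (fun s ↦ chartAt E (γ t) (γ s)) =ᶠ[𝓝 t] fun s ↦ chartAt E (γ t) (η s) :=
    h.fun_comp _
  rw [acceleration_eq_lorentzForce_iff g F he hγ hs] at hm
  rw [acceleration_eq_lorentzForce_iff g F he (hγ.congr_of_eventuallyEq h.symm)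
    (by rwa [← h.self_of_nhds]), ← h1.deriv.deriv_eq, ← h1.deriv_eq, ← h.self_of_nhds, hm]

/-- A map that agrees locally with magnetic curves is a magnetic curve. -/
theorem isMagneticCurve_of_locally {g : RiemMetric E M} {F : MagneticField E M} {γ : ℝ → M}
    {J : Set ℝ} (hJ : IsOpenInterval J)
    (h : ∀ t ∈ J, ∃ (η : ℝ → M) (K : Set ℝ), IsMagneticCurve g F η K ∧ t ∈ K ∧ η =ᶠ[𝓝 t] γ) :
    IsMagneticCurve g F γ J := by
  refine ⟨hJ, fun t ht ↦ ?_, fun t ht ↦ ?_⟩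
  · obtain ⟨η, K, hη, htK, hev⟩ := h t ht
    exact ((hη.contMDiffAt htK).congr_of_eventuallyEq hev.symm).contMDiffWithinAt
  · obtain ⟨η, K, hη, htK, hev⟩ := h t ht
    exact acceleration_eq_lorentzForce_congr g F hev (hη.contMDiffAt htK) (hη.2.2 t htK)

/-- The magnetic field that vanishes identically. -/
def zeroField (E : Type*) [NormedAddCommGroup E] [NormedSpace ℝ E]
    (M : Type*) [TopologicalSpace M] [ChartedSpace E M] [IsManifold 𝓘(ℝ, E) ∞ M] :
    MagneticField E M where
  form _ := 0
  alternating _ _ := rfl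
  smooth := Bundle.contMDiff_zeroSection ℝ
    (fun x : M ↦ TangentSpace 𝓘(ℝ, E) x →L[ℝ] TangentSpace 𝓘(ℝ, E) x →L[ℝ] ℝ)
  closed p y _ u v w := by
    have h : localRep (fun x : M ↦ (0 : TangentSpace 𝓘(ℝ, E) x →L[ℝ]
        TangentSpace 𝓘(ℝ, E) x →L[ℝ] ℝ)) (chartAt E p) = fun _ ↦ 0 := by
      ext y v w
      rfl
    rw [h]
    simp

/-- Through this, uniqueness, gluing and constancy of speed, proved for magnetic curves, apply to
geodesics. -/
theorem isGeodesic_iff (g : RiemMetric E M) (γ : ℝ → M) (J : Set ℝ) :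
    IsGeodesic g γ J ↔ IsMagneticCurve g (zeroField E M) γ J := by
  have h (x : M) (v : TangentSpace 𝓘(ℝ, E) x) : lorentzForce g (zeroField E M) x v = 0 :=
    map_zero (g.inner x).inverse
  simp only [IsGeodesic, IsMagneticCurve, h]

theorem coordForce_zeroField (g : RiemMetric E M) (e : OpenPartialHomeomorph M E) (p : E × E) :
    coordForce g (zeroField E M) e p = - christoffelL g e p.1 p.2 p.2 := by
  have h : localRep (zeroField E M).form e p.1 p.2 = 0 := rfl
  rw [coordForce, h, map_zero, zero_sub]

end Equation

/-! ### Constant speed, uniqueness, and maximal extension of geodesics -/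

theorem hasDerivWithinAt_bilin {E : Type*} [NormedAddCommGroup E] [NormedSpace ℝ E]
    {G : E → E →L[ℝ] E →L[ℝ] ℝ} {G' : E →L[ℝ] E →L[ℝ] E →L[ℝ] ℝ} {c u v : ℝ → E} {c' u' v' : E}
    {t : ℝ} {s : Set ℝ} (hG : HasFDerivAt G G' (c t)) (hc : HasDerivWithinAt c c' s t)
    (hu : HasDerivWithinAt u u' s t) (hv : HasDerivWithinAt v v' s t) :
    HasDerivWithinAt (fun r ↦ G (c r) (u r) (v r))
      (G' c' (u t) (v t) + G (c t) u' (v t) + G (c t) (u t) v') s t := by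
  have h := ((hG.comp_hasDerivWithinAt t hc).clm_apply hu).clm_apply hv
  refine h.congr_deriv ?_
  simp only [Function.comp_apply, add_apply]

section Properties

variable {E : Type*} [NormedAddCommGroup E] [NormedSpace ℝ E] [FiniteDimensional ℝ E]
  {M : Type*} [TopologicalSpace M] [ChartedSpace E M] [IsManifold 𝓘(ℝ, E) ∞ M]
  {g : RiemMetric E M} {F : MagneticField E M} {γ : ℝ → M} {J : Set ℝ}

theorem isOpenInterval_Ioo {a b : ℝ} (h : a < b) : IsOpenInterval (Ioo a b) :=
  ⟨nonempty_Ioo.2 h, isOpen_Ioo, ordConnected_Ioo⟩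

/-- The square of the speed of a curve. -/
def speedSq (g : RiemMetric E M) (γ : ℝ → M) (t : ℝ) : ℝ :=
  g.inner (γ t) (velocity γ t) (velocity γ t)

theorem speedSq_eq_localRep (g : RiemMetric E M) {e : OpenPartialHomeomorph M E}
    (he : e ∈ IsManifold.maximalAtlas 𝓘(ℝ, E) ∞ M) {t : ℝ}
    (hγ : MDifferentiableAt 𝓘(ℝ, ℝ) 𝓘(ℝ, E) γ t) (ht : γ t ∈ e.source) :
    speedSq g γ t = localRep g.inner e (e (γ t)) (deriv (fun s ↦ e (γ s)) t)
      (deriv (fun s ↦ e (γ s)) t) := by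
  rw [(chartDeriv_velocity he hγ ht).deriv, localRep_chartDeriv _ he ht, speedSq]

/-- Pairing with the metric removes its inverse and leaves the Euler–Lagrange form of the equation,
the form used for the conservation of speed and for the minimality of geodesics. -/
theorem localRep_coordForce (g : RiemMetric E M) (F : MagneticField E M)
    {e : OpenPartialHomeomorph M E} (he : e ∈ IsManifold.maximalAtlas 𝓘(ℝ, E) ∞ M) {y : E}
    (hy : y ∈ e.target) (v z : E) :
    localRep g.inner e y (coordForce g F e (y, v)) z = localRep F.form e y v z
      - fderiv ℝ (localRep g.inner e) y v v z + fderiv ℝ (localRep g.inner e) y z v v / 2 := by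
  rw [coordForce, map_sub, sub_apply, (localRep_inner_isInvertible g he hy).self_apply_inverse,
    christoffelL_apply, localRep_christoffel g (maximalAtlas_one he) hy]
  ring

theorem IsMagneticCurve.hasDerivAt_coord_fst (h : IsMagneticCurve g F γ J)
    {e : OpenPartialHomeomorph M E} (he : e ∈ IsManifold.maximalAtlas 𝓘(ℝ, E) ∞ M) {t : ℝ}
    (ht : t ∈ J) (hs : γ t ∈ e.source) :
    HasDerivAt (fun s ↦ e (γ s)) (deriv (fun s ↦ e (γ s)) t) t :=
  (h.hasDerivAt_coord he ht hs).fst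

theorem IsMagneticCurve.hasDerivAt_coord_snd (h : IsMagneticCurve g F γ J)
    {e : OpenPartialHomeomorph M E} (he : e ∈ IsManifold.maximalAtlas 𝓘(ℝ, E) ∞ M) {t : ℝ}
    (ht : t ∈ J) (hs : γ t ∈ e.source) :
    HasDerivAt (deriv fun s ↦ e (γ s))
      (coordForce g F e (e (γ t), deriv (fun s ↦ e (γ s)) t)) t :=
  (h.hasDerivAt_coord he ht hs).snd

/-- The derivative ∂_v G(v, v) of the metric cancels against twice the Christoffel part of G(v'',
v), and the magnetic part is F(v, v) = 0. -/
theorem IsMagneticCurve.hasDerivAt_speedSq (h : IsMagneticCurve g F γ J) {t : ℝ} (ht : t ∈ J) :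
    HasDerivAt (speedSq g γ) 0 t := by
  set e := chartAt E (γ t)
  have he : e ∈ IsManifold.maximalAtlas 𝓘(ℝ, E) ∞ M := IsManifold.chart_mem_maximalAtlas (γ t)
  have hs : γ t ∈ e.source := mem_chart_source E (γ t)
  have hy : e (γ t) ∈ e.target := e.map_source hs
  have hev : ∀ᶠ s in 𝓝 t, speedSq g γ s = localRep g.inner e (e (γ s))
      (deriv (fun s ↦ e (γ s)) s) (deriv (fun s ↦ e (γ s)) s) := by
    filter_upwards [h.1.2.1.mem_nhds ht,
      (h.contMDiffAt ht).continuousAt.eventually (e.open_source.mem_nhds hs)] with s hsJ hse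
    exact speedSq_eq_localRep g he ((h.contMDiffAt hsJ).mdifferentiableAt (by simp)) hse
  have hG : HasFDerivAt (localRep g.inner e) (fderiv ℝ (localRep g.inner e) (e (γ t))) (e (γ t)) :=
    (((contDiffOn_localRep_inner g he).contDiffAt
      (e.open_target.mem_nhds hy)).differentiableAt (by simp)).hasFDerivAt
  have h2 := (h.hasDerivAt_coord_snd he ht hs).hasDerivWithinAt (s := univ)
  have h3 := (hasDerivWithinAt_bilin hG ((h.hasDerivAt_coord_fst he ht hs).hasDerivWithinAt)
    h2 h2).hasDerivAt univ_mem
  refine (h3.congr_of_eventuallyEq hev).congr_deriv ?_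
  generalize deriv (fun s ↦ e (γ s)) t = v
  have hF : localRep F.form e (e (γ t)) v v = 0 := F.alternating _ _
  rw [localRep_inner_symm g e _ v (coordForce g F e _), localRep_coordForce g F he hy, hF]
  ring

theorem IsMagneticCurve.speedSq_eq (h : IsMagneticCurve g F γ J) {s t : ℝ} (hs : s ∈ J)
    (ht : t ∈ J) : speedSq g γ s = speedSq g γ t :=
  h.1.2.1.is_const_of_deriv_eq_zero h.1.2.2.isPreconnected
    (fun _ hu ↦ (h.hasDerivAt_speedSq hu).differentiableAt.differentiableWithinAt)
    (fun _ hu ↦ (h.hasDerivAt_speedSq hu).deriv) hs ht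

theorem IsMagneticCurve.eventuallyEq {η : ℝ → M} (h : IsMagneticCurve g F γ J)
    (h' : IsMagneticCurve g F η J) {e : OpenPartialHomeomorph M E}
    (he : e ∈ IsManifold.maximalAtlas 𝓘(ℝ, E) ∞ M) {t : ℝ} (ht : t ∈ J) (hs : γ t ∈ e.source)
    (h0 : γ t = η t) (h1 : deriv (fun s ↦ e (γ s)) t = deriv (fun s ↦ e (η s)) t) :
    γ =ᶠ[𝓝 t] η := by
  have hX : ContDiffAt ℝ 1 (coordForce g F e) (e (γ t), deriv (fun s ↦ e (γ s)) t) :=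
    ((contDiffOn_coordForce g F he).contDiffAt ((e.open_target.prod isOpen_univ).mem_nhds
      ⟨e.map_source hs, mem_univ _⟩)).of_le (by norm_cast)
  have hX' : ContDiffAt ℝ 1 (fun p : E × E ↦ (p.2, coordForce g F e p))
    (e (γ t), deriv (fun s ↦ e (γ s)) t) := contDiffAt_snd.prodMk hX
  obtain ⟨K, s, hs', hL⟩ := hX'.exists_lipschitzOnWith
  have aux (ζ : ℝ → M) (hζ : IsMagneticCurve g F ζ J) (hζs : ζ t ∈ e.source)
      (hζt : s ∈ 𝓝 (e (ζ t), deriv (fun s ↦ e (ζ s)) t)) :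
      ∀ᶠ u in 𝓝 t, ζ u ∈ e.source ∧
        HasDerivAt (fun s ↦ (e (ζ s), deriv (fun s ↦ e (ζ s)) s))
        ((fun p : E × E ↦ (p.2, coordForce g F e p)) (e (ζ u), deriv (fun s ↦ e (ζ s)) u)) u ∧
        (e (ζ u), deriv (fun s ↦ e (ζ s)) u) ∈ s := by
    filter_upwards [hζ.1.2.1.mem_nhds ht,
      (hζ.contMDiffAt ht).continuousAt.eventually (e.open_source.mem_nhds hζs),
      (hζ.hasDerivAt_coord he ht hζs).continuousAt.eventually hζt] with u hu1 hu2 hu3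
    exact ⟨hu2, hζ.hasDerivAt_coord he hu1 hu2, hu3⟩
  have a1 := aux γ h hs hs'
  have a2 := aux η h' (h0 ▸ hs) (by rwa [← h0, ← h1])
  have key := ODE_solution_unique_of_eventually (v := fun _ p ↦ (p.2, coordForce g F e p))
    (s := fun _ ↦ s) (Eventually.of_forall fun _ ↦ hL) (a1.mono fun u hu ↦ hu.2)
    (a2.mono fun u hu ↦ hu.2) (by simp only [h0, h1])
  filter_upwards [a1, a2, key] with u h1 h2 h3
  exact e.injOn h1.1 h2.1 (congrArg Prod.fst h3)

/-- The set of times at which the germs agree is open. At a limit of such times in `J` the positions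
agree because `M` is Hausdorff, and the velocities by continuity, so local uniqueness shows that the
set is also closed in the interval `J`. -/
theorem IsMagneticCurve.eqOn [T2Space M] {η : ℝ → M} (h : IsMagneticCurve g F γ J)
    (h' : IsMagneticCurve g F η J) {t : ℝ} (ht : t ∈ J) (hev : γ =ᶠ[𝓝 t] η) : EqOn γ η J := by
  have hU : IsOpen {s | γ =ᶠ[𝓝 s] η} := isOpen_setOfPred_eventually_nhds
  have := h.1.2.2.isPreconnected.subset_of_closure_inter_subset hU ⟨t, ht, hev⟩ ?_
  · exact fun s hs ↦ (this hs).self_of_nhds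
  rintro s ⟨hsc, hsJ⟩
  have hf : ∃ᶠ u in 𝓝 s, γ =ᶠ[𝓝 u] η := mem_closure_iff_frequently.1 hsc
  have h0 : γ s = η s := tendsto_nhds_unique_of_frequently_eq (h.contMDiffAt hsJ).continuousAt
    (h'.contMDiffAt hsJ).continuousAt (hf.mono fun u hu ↦ hu.self_of_nhds)
  have he : chartAt E (γ s) ∈ IsManifold.maximalAtlas 𝓘(ℝ, E) ∞ M :=
    IsManifold.chart_mem_maximalAtlas (γ s)
  have hs : γ s ∈ (chartAt E (γ s)).source := mem_chart_source E (γ s)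
  refine h.eventuallyEq h' he hsJ hs h0 ?_
  refine tendsto_nhds_unique_of_frequently_eq (h.hasDerivAt_coord_snd he hsJ hs).continuousAt
    (h'.hasDerivAt_coord_snd he hsJ (h0 ▸ hs)).continuousAt (hf.mono fun u hu ↦ ?_)
  exact (hu.fun_comp (chartAt E (γ s))).deriv_eq

theorem IsMagneticCurve.comp_add_const (h : IsMagneticCurve g F γ J) (a : ℝ) :
    IsMagneticCurve g F (fun t ↦ γ (t + a)) ((· + a) ⁻¹' J) := by
  have hc : Continuous fun t : ℝ ↦ t + a := by fun_prop
  have hI : IsOpenInterval ((· + a) ⁻¹' J) := by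
    refine ⟨?_, h.1.2.1.preimage hc, ?_⟩
    · obtain ⟨t, ht⟩ := h.1.1
      exact ⟨t - a, by simpa using ht⟩
    · exact h.1.2.2.preimage_mono fun x y hxy ↦ by simpa using hxy
  have hsm (t : ℝ) (ht : t + a ∈ J) :
      ContMDiffAt 𝓘(ℝ, ℝ) 𝓘(ℝ, E) ∞ (fun t ↦ γ (t + a)) t :=
    ContMDiffAt.comp (I' := 𝓘(ℝ, ℝ)) t (g := γ) (f := fun t : ℝ ↦ t + a) (h.contMDiffAt ht)
      (contMDiffAt_iff_contDiffAt.2 (contDiffAt_id.add contDiffAt_const))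
  refine ⟨hI, fun t ht ↦ (hsm t ht).contMDiffWithinAt, fun t ht ↦ ?_⟩
  have he : chartAt E (γ (t + a)) ∈ IsManifold.maximalAtlas 𝓘(ℝ, E) ∞ M :=
    IsManifold.chart_mem_maximalAtlas _
  have hs : γ (t + a) ∈ (chartAt E (γ (t + a))).source := mem_chart_source E _
  have h1 := (acceleration_eq_lorentzForce_iff g F he (h.contMDiffAt ht) hs).1 (h.2.2 _ ht)
  rw [acceleration_eq_lorentzForce_iff g F he (hsm t ht) hs]
  have h2 (c : ℝ → E) : deriv (fun s ↦ c (s + a)) = fun s ↦ deriv c (s + a) :=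
    funext fun s ↦ deriv_comp_add_const c a s
  rw [h2 fun s ↦ chartAt E (γ (t + a)) (γ s), h2]
  exact h1

/-- Every geodesic of a geodesically complete manifold extends to `ℝ`. -/
theorem GeodesicallyComplete.exists_extension (hg : GeodesicallyComplete g)
    (hγ : IsGeodesic g γ J) : ∃ η : ℝ → M, IsGeodesic g η univ ∧ EqOn η γ J := by
  let P := {p : (ℝ → M) × Set ℝ // IsGeodesic g p.1 p.2 ∧ J ⊆ p.2 ∧ EqOn p.1 γ J}
  let r (p q : P) : Prop := p.1.2 ⊆ q.1.2 ∧ EqOn q.1.1 p.1.1 p.1.2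
  -- Completeness speaks only of inextendible geodesics, so a maximal extension is produced first,
  -- by Zorn's lemma.
  obtain ⟨m, hm⟩ : ∃ m : P, ∀ a, r m a → r a m := by
    refine exists_maximal_of_chains_bounded (fun C hC ↦ ?_)
      fun {a b c} hab hbc ↦ ⟨hab.1.trans hbc.1, (hbc.2.mono hab.1).trans hab.2⟩
    rcases C.eq_empty_or_nonempty with rfl | ⟨p₀, hp₀⟩
    · exact ⟨⟨(γ, J), hγ, subset_rfl, fun _ _ ↦ rfl⟩, by simp⟩
    classical
    let K : Set ℝ := ⋃ p ∈ C, p.1.2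
    -- The choice is immaterial: members of the chain agree wherever both are defined.
    let η : ℝ → M := fun t ↦ if h : ∃ p ∈ C, t ∈ p.1.2 then h.choose.1.1 t else γ t
    have htot {p q : P} (hp : p ∈ C) (hq : q ∈ C) : r p q ∨ r q p := by
      rcases eq_or_ne p q with rfl | hne
      · exact Or.inl ⟨subset_rfl, fun _ _ ↦ rfl⟩
      · exact hC hp hq hne
    have hη {p : P} (hp : p ∈ C) : EqOn η p.1.1 p.1.2 := by
      intro t ht
      have h : ∃ p ∈ C, t ∈ p.1.2 := ⟨p, hp, ht⟩
      simp only [η, dif_pos h]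
      rcases htot hp h.choose_spec.1 with h1 | h1
      · exact h1.2 ht
      · exact (h1.2 h.choose_spec.2).symm
    have hsub {p : P} (hp : p ∈ C) : p.1.2 ⊆ K := subset_biUnion_of_mem (u := fun p : P ↦ p.1.2) hp
    have hK : IsOpenInterval K := by
      refine ⟨p₀.2.1.1.1.mono (hsub hp₀), isOpen_biUnion fun p _ ↦ p.2.1.1.2.1, ⟨?_⟩⟩
      intro x hx y hy
      obtain ⟨p, hp, hxp⟩ := mem_iUnion₂.1 hx
      obtain ⟨q, hq, hyq⟩ := mem_iUnion₂.1 hy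
      rcases htot hp hq with h1 | h1
      · exact (q.2.1.1.2.2.out (h1.1 hxp) hyq).trans (hsub hq)
      · exact (p.2.1.1.2.2.out hxp (h1.1 hyq)).trans (hsub hp)
    have hgeo : IsGeodesic g η K := by
      rw [isGeodesic_iff]
      refine isMagneticCurve_of_locally hK fun t ht ↦ ?_
      obtain ⟨p, hp, htp⟩ := mem_iUnion₂.1 ht
      exact ⟨p.1.1, p.1.2, (isGeodesic_iff _ _ _).1 p.2.1, htp,
        (hη hp).symm.eventuallyEq_of_mem (p.2.1.1.2.1.mem_nhds htp)⟩
    exact ⟨⟨(η, K), hgeo, p₀.2.2.1.trans (hsub hp₀),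
      ((hη hp₀).mono p₀.2.2.1).trans p₀.2.2.2⟩, fun p hp ↦ ⟨hsub hp, hη hp⟩⟩
  have hK : m.1.2 = univ := by
    refine hg m.1.1 m.1.2 ⟨m.2.1, fun η K hη hJK heq ↦ ?_⟩
    exact Subset.antisymm (hm ⟨(η, K), hη, m.2.2.1.trans hJK, (heq.mono m.2.2.1).trans m.2.2.2⟩
      ⟨hJK, heq⟩).1 hJK
  exact ⟨m.1.1, hK ▸ m.2.1, m.2.2.2⟩

end Properties

/-! ### Short geodesics with prescribed endpoints -/

section BoundaryValue

variable {E : Type*} [NormedAddCommGroup E] [NormedSpace ℝ E] [FiniteDimensional ℝ E]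

/-- The primitive vanishing at `0` of a continuous function on the unit interval. -/
def primitiveCLM (E : Type*) [NormedAddCommGroup E] [NormedSpace ℝ E] [FiniteDimensional ℝ E] :
    C(Icc (0 : ℝ) 1, E) →L[ℝ] C(Icc (0 : ℝ) 1, E) :=
  LinearMap.mkContinuous
    { toFun := fun f ↦ ⟨fun t ↦ ∫ s in (0 : ℝ)..t, IccExtend zero_le_one f s,
        (intervalIntegral.continuous_primitive
          (fun a b ↦ (f.continuous.Icc_extend').intervalIntegrable a b) 0).comp
          continuous_subtype_val⟩
      map_add' := fun f h ↦ by
        ext t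
        exact intervalIntegral.integral_add ((f.continuous.Icc_extend').intervalIntegrable _ _)
          ((h.continuous.Icc_extend').intervalIntegrable _ _)
      map_smul' := fun a f ↦ by
        ext t
        exact intervalIntegral.integral_smul a _ } 1 (fun f ↦ by
      rw [one_mul, ContinuousMap.norm_le _ (norm_nonneg f)]
      intro t
      have h := intervalIntegral.norm_integral_le_of_norm_le_const (a := 0) (b := (t : ℝ))
        (f := IccExtend zero_le_one f) (C := ‖f‖) fun s _ ↦ f.norm_coe_le_norm _
      refine h.trans (mul_le_of_le_one_right (norm_nonneg f) ?_)
      rw [sub_zero, abs_of_nonneg t.2.1]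
      exact t.2.2)

theorem primitiveCLM_apply (f : C(Icc (0 : ℝ) 1, E)) (t : Icc (0 : ℝ) 1) :
    primitiveCLM E f t = ∫ s in (0 : ℝ)..t, IccExtend zero_le_one f s :=
  rfl

theorem norm_primitiveCLM_le (f : C(Icc (0 : ℝ) 1, E)) : ‖primitiveCLM E f‖ ≤ ‖f‖ := by
  simpa using (LinearMap.mkContinuous_norm_le _ zero_le_one _ : ‖primitiveCLM E‖ ≤ 1)
    |> (primitiveCLM E).le_of_opNorm_le (x := f)

theorem hasDerivAt_primitive (f : C(Icc (0 : ℝ) 1, E)) (t : ℝ) :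
    HasDerivAt (fun t : ℝ ↦ ∫ s in (0 : ℝ)..t, IccExtend zero_le_one f s)
      (IccExtend zero_le_one f t) t :=
  intervalIntegral.integral_hasDerivAt_right
    ((f.continuous.Icc_extend').intervalIntegrable _ _)
    ((f.continuous.Icc_extend').stronglyMeasurableAtFilter _ _)
    (f.continuous.Icc_extend').continuousAt

/-- The quadratic term `Γ(c)(w, w)` of the geodesic equation as a function of the velocity `w` of
the curve `c` issuing from `x`. -/
def quadTerm (Γ : E → E →L[ℝ] E →L[ℝ] E) (hΓ : Continuous Γ) (x : E) (w : C(Icc (0 : ℝ) 1, E)) :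
    C(Icc (0 : ℝ) 1, E) :=
  ⟨fun t ↦ Γ (x + primitiveCLM E w t) (w t) (w t), by fun_prop⟩

theorem norm_quadTerm_le {Γ : E → E →L[ℝ] E →L[ℝ] E} (hΓ : Continuous Γ) {x : E} {C r : ℝ}
    (hC : ∀ z, ‖z - x‖ ≤ r → ‖Γ z‖ ≤ C) (hC0 : 0 ≤ C) {w : C(Icc (0 : ℝ) 1, E)} (hw : ‖w‖ ≤ r) :
    ‖quadTerm Γ hΓ x w‖ ≤ C * r ^ 2 := by
  have hr : 0 ≤ r := (norm_nonneg _).trans hw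
  rw [ContinuousMap.norm_le _ (by positivity)]
  intro t
  have h1 : ‖w t‖ ≤ r := (w.norm_coe_le_norm t).trans hw
  have h2 : ‖Γ (x + primitiveCLM E w t)‖ ≤ C := hC _ (by
    rw [add_sub_cancel_left]
    exact ((primitiveCLM E w).norm_coe_le_norm t).trans ((norm_primitiveCLM_le w).trans hw))
  calc ‖Γ (x + primitiveCLM E w t) (w t) (w t)‖
      ≤ ‖Γ (x + primitiveCLM E w t)‖ * ‖w t‖ * ‖w t‖ := ContinuousLinearMap.le_opNorm₂ _ _ _
    _ ≤ C * r * r := by gcongr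
    _ = C * r ^ 2 := by ring

theorem norm_quadTerm_sub_le {Γ : E → E →L[ℝ] E →L[ℝ] E} (hΓ : Continuous Γ) {x : E} {C r : ℝ}
    (hC : ∀ z, ‖z - x‖ ≤ r → ‖Γ z‖ ≤ C) (hL : ∀ z z', ‖Γ z - Γ z'‖ ≤ C * ‖z - z'‖) (hC0 : 0 ≤ C)
    {w w' : C(Icc (0 : ℝ) 1, E)} (hw : ‖w‖ ≤ r) (hw' : ‖w'‖ ≤ r) :
    ‖quadTerm Γ hΓ x w - quadTerm Γ hΓ x w'‖ ≤ (C * r ^ 2 + 2 * C * r) * ‖w - w'‖ := by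
  have hr : 0 ≤ r := (norm_nonneg _).trans hw
  rw [ContinuousMap.norm_le _ (by positivity)]
  intro t
  have h1 : ‖w t‖ ≤ r := (w.norm_coe_le_norm t).trans hw
  have h1' : ‖w' t‖ ≤ r := (w'.norm_coe_le_norm t).trans hw'
  have hd : ‖w t - w' t‖ ≤ ‖w - w'‖ := (w - w').norm_coe_le_norm t
  have h2 : ‖Γ (x + primitiveCLM E w' t)‖ ≤ C := hC _ (by
    rw [add_sub_cancel_left]
    exact ((primitiveCLM E w').norm_coe_le_norm t).trans ((norm_primitiveCLM_le w').trans hw'))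
  have h3 : ‖Γ (x + primitiveCLM E w t) - Γ (x + primitiveCLM E w' t)‖ ≤ C * ‖w - w'‖ := by
    refine (hL _ _).trans (mul_le_mul_of_nonneg_left ?_ hC0)
    rw [add_sub_add_left_eq_sub, ← ContinuousMap.sub_apply, ← map_sub]
    exact ((primitiveCLM E (w - w')).norm_coe_le_norm t).trans (norm_primitiveCLM_le _)
  set A := Γ (x + primitiveCLM E w t)
  set B := Γ (x + primitiveCLM E w' t)
  have hsplit : (quadTerm Γ hΓ x w - quadTerm Γ hΓ x w') t =
      (A - B) (w t) (w t) + B (w t - w' t) (w t) + B (w' t) (w t - w' t) := by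
    change A (w t) (w t) - B (w' t) (w' t) = _
    simp only [sub_apply, map_sub]
    abel
  rw [hsplit]
  calc _ ≤ ‖A - B‖ * ‖w t‖ * ‖w t‖ + ‖B‖ * ‖w t - w' t‖ * ‖w t‖ + ‖B‖ * ‖w' t‖ * ‖w t - w' t‖ :=
        norm_add₃_le.trans (add_le_add (add_le_add (ContinuousLinearMap.le_opNorm₂ _ _ _)
          (ContinuousLinearMap.le_opNorm₂ _ _ _)) (ContinuousLinearMap.le_opNorm₂ _ _ _))
    _ ≤ (C * ‖w - w'‖) * r * r + C * ‖w - w'‖ * r + C * r * ‖w - w'‖ := by gcongr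
    _ = _ := by ring

/-- The operator whose fixed point is the velocity of the geodesic from `x` to `y`. -/
def shootingMap (Γ : E → E →L[ℝ] E →L[ℝ] E) (hΓ : Continuous Γ) (x y : E)
    (w : C(Icc (0 : ℝ) 1, E)) : C(Icc (0 : ℝ) 1, E) :=
  ContinuousMap.const _ (y - x) - primitiveCLM E (quadTerm Γ hΓ x w)
    + ContinuousMap.const _ (primitiveCLM E (primitiveCLM E (quadTerm Γ hΓ x w)) 1)

theorem norm_const_le (y : E) : ‖ContinuousMap.const (Icc (0 : ℝ) 1) y‖ ≤ ‖y‖ :=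
  (ContinuousMap.norm_le _ (norm_nonneg y)).2 fun _ ↦ le_rfl

theorem norm_const_primitive_le (f : C(Icc (0 : ℝ) 1, E)) :
    ‖ContinuousMap.const (Icc (0 : ℝ) 1) (primitiveCLM E (primitiveCLM E f) 1)‖ ≤ ‖f‖ :=
  (norm_const_le _).trans (((primitiveCLM E (primitiveCLM E f)).norm_coe_le_norm 1).trans
    ((norm_primitiveCLM_le _).trans (norm_primitiveCLM_le f)))

theorem norm_shootingMap_le (Γ : E → E →L[ℝ] E →L[ℝ] E) (hΓ : Continuous Γ) (x y : E)
    (w : C(Icc (0 : ℝ) 1, E)) :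
    ‖shootingMap Γ hΓ x y w‖ ≤ ‖y - x‖ + 2 * ‖quadTerm Γ hΓ x w‖ := by
  have h1 := norm_primitiveCLM_le (quadTerm Γ hΓ x w)
  have h2 := norm_const_primitive_le (quadTerm Γ hΓ x w)
  have h3 := norm_const_le (y - x)
  refine (norm_add_le _ _).trans ((add_le_add_left (norm_sub_le _ _) _).trans ?_)
  linarith

theorem norm_shootingMap_sub_le (Γ : E → E →L[ℝ] E →L[ℝ] E) (hΓ : Continuous Γ) (x y y' : E)
    (w w' : C(Icc (0 : ℝ) 1, E)) :
    ‖shootingMap Γ hΓ x y w - shootingMap Γ hΓ x y' w'‖ ≤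
      ‖y - y'‖ + 2 * ‖quadTerm Γ hΓ x w - quadTerm Γ hΓ x w'‖ := by
  have h1 := norm_primitiveCLM_le (quadTerm Γ hΓ x w - quadTerm Γ hΓ x w')
  have h2 := norm_const_primitive_le (quadTerm Γ hΓ x w - quadTerm Γ hΓ x w')
  have h3 := norm_const_le (y - y')
  have heq : shootingMap Γ hΓ x y w - shootingMap Γ hΓ x y' w' =
      ContinuousMap.const _ (y - y')
        - primitiveCLM E (quadTerm Γ hΓ x w - quadTerm Γ hΓ x w')
        + ContinuousMap.const _
          (primitiveCLM E (primitiveCLM E (quadTerm Γ hΓ x w - quadTerm Γ hΓ x w')) 1) := by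
    ext t
    simp only [shootingMap, map_sub, ContinuousMap.sub_apply, ContinuousMap.add_apply,
      ContinuousMap.const_apply]
    abel
  rw [heq]
  refine (norm_add_le _ _).trans ((add_le_add_left (norm_sub_le _ _) _).trans ?_)
  linarith

/-- With Q = Γ(c)(w, w) and w = c', the boundary value problem reads w(t) = y - x - ∫₀ᵗ Q + ∫₀¹ ∫₀ˢ
Q, the last constant being what forces ∫₀¹ w = y - x. Since Q is quadratic in the velocity, the
right-hand side is a contraction on a small ball of velocities, with a fixed point that depends on y
in a Lipschitz way. -/
theorem exists_connecting_geodesics {Γ : E → E →L[ℝ] E →L[ℝ] E} {x : E}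
    (hΓ : ContDiffAt ℝ 1 Γ x) {κ : ℝ} (hκ : 0 < κ) :
    ∃ ρ > 0, ρ ≤ κ ∧ ∃ c w : E → ℝ → E,
      (∀ y ∈ Metric.closedBall x ρ, c y 0 = x ∧ c y 1 = y ∧ ∀ t ∈ Icc (0 : ℝ) 1,
        HasDerivWithinAt (c y) (w y t) (Icc 0 1) t ∧
        HasDerivWithinAt (w y) (- Γ (c y t) (w y t) (w y t)) (Icc 0 1) t ∧
        ‖w y t‖ ≤ κ ∧ ‖c y t - x‖ ≤ κ) ∧
      ContinuousOn (fun y ↦ w y 0) (Metric.closedBall x ρ) := by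
  obtain ⟨K, s, hs, hL⟩ := hΓ.exists_lipschitzOnWith
  -- A global Lipschitz extension makes the operator act on all continuous functions; the fixed
  -- points will give curves staying where `Γ' = Γ`.
  obtain ⟨Γ', hL', heq⟩ := hL.extend_finite_dimension
  obtain ⟨δ, hδ, hδs⟩ := Metric.mem_nhds_iff.1 hs
  generalize lipschitzExtensionConstant (E →L[ℝ] E →L[ℝ] E) * K = K' at hL'
  have hc' : Continuous Γ' := hL'.continuous
  set C : ℝ := K' + ‖Γ' x‖ + 1 with hC_def
  have hC1 : 1 ≤ C := by
    have : 0 ≤ (K' : ℝ) := K'.2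
    have := norm_nonneg (Γ' x)
    linarith
  have hC0 : 0 ≤ C := by linarith
  -- As r ≤ 1, the last condition gives C r² + 2 C r ≤ 1/4, hence the contraction factor 1/2, and
  -- r/2 + 2 C r² ≤ r, hence invariance of the ball of radius r. The bound r ≤ δ/2 keeps the curves
  -- in the set where `Γ' = Γ`.
  obtain ⟨r, hr0, hr⟩ : ∃ r > 0, r ≤ κ ∧ r ≤ 1 ∧ r ≤ δ / 2 ∧ 12 * C * r ≤ 1 := by
    refine ⟨min (min κ 1) (min (δ / 2) (1 / (12 * C))), by positivity, ?_, ?_, ?_, ?_⟩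
    · exact (min_le_left _ _).trans (min_le_left _ _)
    · exact (min_le_left _ _).trans (min_le_right _ _)
    · exact (min_le_right _ _).trans (min_le_left _ _)
    · calc _ ≤ 12 * C * (1 / (12 * C)) := by
            gcongr
            exact (min_le_right _ _).trans (min_le_right _ _)
        _ = 1 := by field_simp
  obtain ⟨hrκ, hr1, hrδ, hrC⟩ := hr
  have hLC (z z' : E) : ‖Γ' z - Γ' z'‖ ≤ C * ‖z - z'‖ := by
    refine (hL'.norm_sub_le z z').trans (mul_le_mul_of_nonneg_right ?_ (norm_nonneg _))
    have := norm_nonneg (Γ' x)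
    linarith
  have hbC (z : E) (hz : ‖z - x‖ ≤ r) : ‖Γ' z‖ ≤ C := by
    have h1 := norm_sub_norm_le (Γ' z) (Γ' x)
    have h2 := hL'.norm_sub_le z x
    have h3 : (K' : ℝ) * ‖z - x‖ ≤ K' * 1 := mul_le_mul_of_nonneg_left (hz.trans hr1) K'.2
    linarith
  have hCr : C * r ^ 2 ≤ r / 12 := by nlinarith
  have hlip {y y' : E} {w w' : C(Icc (0 : ℝ) 1, E)} (hw : ‖w‖ ≤ r) (hw' : ‖w'‖ ≤ r) :
      ‖shootingMap Γ' hc' x y w - shootingMap Γ' hc' x y' w'‖ ≤ ‖y - y'‖ + 1 / 2 * ‖w - w'‖ := by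
    refine (norm_shootingMap_sub_le Γ' hc' x y y' w w').trans ?_
    have h1 := norm_quadTerm_sub_le hc' hbC hLC hC0 hw hw'
    have h2 : (C * r ^ 2 + 2 * C * r) * ‖w - w'‖ ≤ 1 / 4 * ‖w - w'‖ :=
      mul_le_mul_of_nonneg_right (by nlinarith) (norm_nonneg _)
    linarith
  have hfix (y : E) (hy : y ∈ Metric.closedBall x (r / 2)) :
      ∃ w : C(Icc (0 : ℝ) 1, E), ‖w‖ ≤ r ∧ shootingMap Γ' hc' x y w = w := by
    have hmaps : MapsTo (shootingMap Γ' hc' x y) (Metric.closedBall 0 r) (Metric.closedBall 0 r) := by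
      intro w hw
      rw [mem_closedBall_zero_iff] at hw ⊢
      have h1 := norm_shootingMap_le Γ' hc' x y w
      have h2 := norm_quadTerm_le hc' hbC hC0 hw
      have h3 : ‖y - x‖ ≤ r / 2 := mem_closedBall_iff_norm.1 hy
      linarith
    have hcontr : ContractingWith (1 / 2) (hmaps.restrict _ _ _) := by
      refine ⟨by norm_num, LipschitzWith.of_dist_le_mul fun w w' ↦ ?_⟩
      have := hlip (y := y) (y' := y) (mem_closedBall_zero_iff.1 w.2)
        (mem_closedBall_zero_iff.1 w'.2)
      simpa [Subtype.dist_eq, dist_eq_norm] using this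
    obtain ⟨w, hw, hfw, -⟩ := hcontr.exists_fixedPoint' Metric.isClosed_closedBall.isComplete hmaps
      (x := 0) (Metric.mem_closedBall_self hr0.le) (edist_ne_top _ _)
    exact ⟨w, mem_closedBall_zero_iff.1 hw, hfw⟩
  choose! w hwr hw using hfix
  refine ⟨r / 2, by positivity, by linarith,
    fun y t ↦ x + ∫ s in (0 : ℝ)..t, IccExtend zero_le_one (w y) s,
    fun y ↦ IccExtend zero_le_one (w y), fun y hy ↦ ?_, ?_⟩
  · have hpos (t : ℝ) (ht : t ∈ Icc (0 : ℝ) 1) :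
        ‖∫ s in (0 : ℝ)..t, IccExtend zero_le_one (w y) s‖ ≤ r :=
      ((primitiveCLM E (w y)).norm_coe_le_norm ⟨t, ht⟩).trans
        ((norm_primitiveCLM_le _).trans (hwr y hy))
    have hwt (t : ℝ) (ht : t ∈ Icc (0 : ℝ) 1) : IccExtend zero_le_one (w y) t =
        y - x - (∫ s in (0 : ℝ)..t, IccExtend zero_le_one (quadTerm Γ' hc' x (w y)) s)
          + primitiveCLM E (primitiveCLM E (quadTerm Γ' hc' x (w y))) 1 := by
      rw [IccExtend_of_mem _ _ ht]
      nth_rewrite 1 [← hw y hy]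
      rfl
    refine ⟨by simp, ?_, fun t ht ↦ ⟨?_, ?_, ?_, ?_⟩⟩
    · have h1 : primitiveCLM E (w y) 1 = y - x := by
        have h2 : primitiveCLM E (ContinuousMap.const (Icc (0 : ℝ) 1) (y - x)) 1 = y - x := by
          rw [primitiveCLM_apply]
          simp [IccExtend]
        have h3 (z : E) : primitiveCLM E (ContinuousMap.const (Icc (0 : ℝ) 1) z) 1 = z := by
          rw [primitiveCLM_apply]
          simp [IccExtend]
        nth_rewrite 1 [← hw y hy]
        rw [shootingMap, map_add, map_sub, ContinuousMap.add_apply, ContinuousMap.sub_apply, h3, h3]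
        abel
      have h2 : (∫ s in (0 : ℝ)..1, IccExtend zero_le_one (w y) s) = y - x := h1
      simp [h2]
    · exact ((hasDerivAt_primitive (w y) t).const_add x).hasDerivWithinAt
    · have h1 := (((hasDerivAt_primitive (quadTerm Γ' hc' x (w y)) t).const_sub (y - x)).add_const
        (primitiveCLM E (primitiveCLM E (quadTerm Γ' hc' x (w y))) 1)).hasDerivWithinAt
        (s := Icc 0 1)
      have h2 : x + ∫ s in (0 : ℝ)..t, IccExtend zero_le_one (w y) s ∈ s := by
        refine hδs ?_
        rw [mem_ball_iff_norm, add_sub_cancel_left]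
        linarith [hpos t ht]
      refine (h1.congr hwt (hwt t ht)).congr_deriv ?_
      beta_reduce
      rw [heq h2, IccExtend_of_mem _ _ ht, IccExtend_of_mem _ _ ht]
      rfl
    · exact ((w y).norm_coe_le_norm _).trans ((hwr y hy).trans hrκ)
    · rw [add_sub_cancel_left]
      exact (hpos t ht).trans hrκ
  -- The constant 2 comes from ‖w - w'‖ ≤ ‖y - y'‖ + ‖w - w'‖ / 2 for two fixed points.
  · have hLip : LipschitzOnWith 2 (fun y ↦ IccExtend zero_le_one (w y) 0)
        (Metric.closedBall x (r / 2)) := by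
      refine LipschitzOnWith.of_dist_le_mul fun y hy y' hy' ↦ ?_
      rw [dist_eq_norm, dist_eq_norm]
      have h1 := hlip (y := y) (y' := y') (hwr y hy) (hwr y' hy')
      rw [hw y hy, hw y' hy'] at h1
      refine ((w y - w y').norm_coe_le_norm (projIcc 0 1 zero_le_one 0)).trans ?_
      push_cast
      linarith
    exact hLip.continuousOn

end BoundaryValue

/-! ### Short geodesics minimize -/

section Minimality

variable {E : Type*} [NormedAddCommGroup E] [NormedSpace ℝ E] [FiniteDimensional ℝ E]

theorem exists_eventually_coercive {G : E → E →L[ℝ] E →L[ℝ] ℝ} {x : E} (hG : ContinuousAt G x)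
    (hpos : ∀ v, v ≠ 0 → 0 < G x v v) :
    ∃ m > 0, ∀ᶠ z in 𝓝 x, ∀ v, m * ‖v‖ ^ 2 ≤ G z v v := by
  obtain ⟨m, hm, hmG⟩ : ∃ m > 0, ∀ v, m * ‖v‖ ^ 2 ≤ G x v v := by
    rcases subsingleton_or_nontrivial E with hE | hE
    · exact ⟨1, one_pos, fun v ↦ by simp [Subsingleton.elim v 0]⟩
    obtain ⟨v₀, hv₀, hmin⟩ := (isCompact_sphere (0 : E) 1).exists_isMinOn
      (NormedSpace.sphere_nonempty.2 zero_le_one) (f := fun v ↦ G x v v) (by fun_prop)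
    have hv₀' : ‖v₀‖ = 1 := by simpa using hv₀
    refine ⟨G x v₀ v₀, hpos _ (norm_pos_iff.1 (by rw [hv₀']; exact one_pos)), fun v ↦ ?_⟩
    rcases eq_or_ne v 0 with rfl | hv
    · simp
    have hn : 0 < ‖v‖ := norm_pos_iff.2 hv
    have h1 : G x v₀ v₀ ≤ G x (‖v‖⁻¹ • v) (‖v‖⁻¹ • v) :=
      hmin (by simp [norm_smul, hn.ne'])
    have h2 : G x v v = ‖v‖ ^ 2 * G x (‖v‖⁻¹ • v) (‖v‖⁻¹ • v) := by
      simp only [map_smul, smul_apply, smul_eq_mul]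
      field_simp
    rw [h2, mul_comm]
    gcongr
  refine ⟨m / 2, by positivity, ?_⟩
  filter_upwards [hG.eventually (Metric.closedBall_mem_nhds _ (half_pos hm))] with z hz v
  have h1 : ‖(G z - G x) v v‖ ≤ m / 2 * ‖v‖ * ‖v‖ :=
    (ContinuousLinearMap.le_opNorm₂ _ _ _).trans (by
      gcongr
      exact mem_closedBall_iff_norm.1 hz)
  have h2 := neg_le_of_abs_le h1
  have h3 := hmG v
  simp only [sub_apply] at h2
  nlinarith

theorem norm_sub_sub_fderiv_le {F : Type*} [NormedAddCommGroup F] [NormedSpace ℝ F] {G : E → F}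
    {s : Set E} (hs : Convex ℝ s) (hG : ∀ z ∈ s, DifferentiableAt ℝ G z) {C : ℝ}
    (hL : ∀ z ∈ s, ∀ z' ∈ s, ‖fderiv ℝ G z - fderiv ℝ G z'‖ ≤ C * ‖z - z'‖) (hC : 0 ≤ C) {y z : E}
    (hy : y ∈ s) (hz : z ∈ s) :
    ‖G z - G y - fderiv ℝ G y (z - y)‖ ≤ C * ‖z - y‖ ^ 2 := by
  have hseg : segment ℝ y z ⊆ s := hs.segment_subset hy hz
  have h := (convex_segment (𝕜 := ℝ) y z).norm_image_sub_le_of_norm_hasFDerivWithin_le'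
    (f := G) (f' := fderiv ℝ G) (φ := fderiv ℝ G y) (C := C * ‖z - y‖)
    (fun p hp ↦ (hG p (hseg hp)).hasFDerivAt.hasFDerivWithinAt) (fun p hp ↦ ?_)
    (left_mem_segment ℝ y z) (right_mem_segment ℝ y z)
  · calc _ ≤ _ := h
      _ = _ := by ring
  · refine (hL p (hseg hp) y hy).trans (mul_le_mul_of_nonneg_left ?_ hC)
    obtain ⟨a, b, ha, hb, hab, rfl⟩ := hp
    have : a • y + b • z - y = b • (z - y) := by
      rw [← eq_sub_iff_add_eq] at hab
      rw [hab]
      module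
    rw [this, norm_smul, Real.norm_of_nonneg hb]
    exact mul_le_of_le_one_left (norm_nonneg _) (by linarith)

/-- The second variation of the energy is nonnegative for slow curves. -/
theorem energy_remainder_nonneg {A B D G₀ : E →L[ℝ] E →L[ℝ] ℝ} {C m κ t : ℝ} {u h η : E}
    (hm : 0 < m) (hκ : 0 ≤ κ) (hC : 0 ≤ C) (hκm : κ * (4 * C ^ 2 + m * C) ≤ m ^ 2)
    (ht0 : 0 ≤ t) (ht1 : t ≤ 1) (hu : ‖u‖ ≤ κ)
    (hBA : ‖B - A‖ ≤ C * ‖η‖) (hBD : ‖B - A - D‖ ≤ C * ‖η‖ ^ 2) (hG₀ : ‖G₀‖ ≤ C)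
    (hB : ∀ v, m * ‖v‖ ^ 2 ≤ B v v) (hG₀m : ∀ v, m * ‖v‖ ^ 2 ≤ G₀ v v) :
    0 ≤ (B - A - D) u u + 2 * (B - A) u h + B h h + κ * G₀ η η + 2 * κ * t * G₀ η h := by
  have hn1 := norm_nonneg η
  have hn2 := norm_nonneg h
  have h1 : -(C * ‖η‖ ^ 2 * κ * κ) ≤ (B - A - D) u u := by
    have h : ‖(B - A - D) u u‖ ≤ C * ‖η‖ ^ 2 * κ * κ :=
      (ContinuousLinearMap.le_opNorm₂ _ _ _).trans (by gcongr)
    exact neg_le_of_abs_le h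
  have h2 : -(C * ‖η‖ * κ * ‖h‖) ≤ (B - A) u h := by
    have h : ‖(B - A) u h‖ ≤ C * ‖η‖ * κ * ‖h‖ :=
      (ContinuousLinearMap.le_opNorm₂ _ _ _).trans (by gcongr)
    exact neg_le_of_abs_le h
  have h5 : -(C * ‖η‖ * ‖h‖) ≤ t * G₀ η h := by
    have h51 : |t * G₀ η h| ≤ C * ‖η‖ * ‖h‖ := by
      have h : ‖G₀ η h‖ ≤ C * ‖η‖ * ‖h‖ :=
        (ContinuousLinearMap.le_opNorm₂ _ _ _).trans (by gcongr)
      rw [abs_mul, abs_of_nonneg ht0]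
      exact (mul_le_of_le_one_left (abs_nonneg _) ht1).trans h
    exact neg_le_of_abs_le h51
  have h3 := hB h
  have h4 := mul_le_mul_of_nonneg_left (hG₀m η) hκ
  have h5' := mul_le_mul_of_nonneg_left h5 hκ
  -- Completing the square in m‖h‖ leaves a multiple of ‖η‖² whose coefficient is nonnegative by
  -- `hκm`.
  have key : 0 ≤ m * (m * ‖h‖ ^ 2 - 4 * C * κ * ‖η‖ * ‖h‖ + (κ * m - C * κ ^ 2) * ‖η‖ ^ 2) := by
    have : 0 ≤ (m * ‖h‖ - 2 * C * κ * ‖η‖) ^ 2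
        + κ * (m ^ 2 - κ * (4 * C ^ 2 + m * C)) * ‖η‖ ^ 2 := by
      have : 0 ≤ m ^ 2 - κ * (4 * C ^ 2 + m * C) := by linarith
      positivity
    linarith
  have key' := nonneg_of_mul_nonneg_right key hm
  linarith

/-- A calibration. Put η = ζ - c and H(t) = 2 G_c(w, η) - κ t G_x(η, η), which vanishes at both
ends. By the geodesic equation the derivative of the first term is the first-order part of the
difference of the energy densities of ζ and c. The second term supplies a margin κ G_x(η, η), which
for small κ absorbs the remainders, of sizes κ²‖η‖² and κ‖η‖‖h‖ with h = η'
(`energy_remainder_nonneg`). So H' ≤ T - G_c(w, w), and integration gives the claim. Right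
derivatives of ζ suffice, which admits curves with corners. -/
theorem exists_geodesic_minimizing {G : E → E →L[ℝ] E →L[ℝ] ℝ} {x : E} (hG : ContDiffAt ℝ 2 G x)
    (hsymm : ∀ y v w, G y v w = G y w v) (hpos : ∀ v, v ≠ 0 → 0 < G x v v) {U : Set E}
    (hU : U ∈ 𝓝 x) :
    ∃ κ > 0, Metric.closedBall x κ ⊆ U ∧ ∀ (c w a : ℝ → E),
      (∀ t ∈ Icc (0 : ℝ) 1, HasDerivWithinAt c (w t) (Icc 0 1) t ∧
        HasDerivWithinAt w (a t) (Icc 0 1) t ∧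
        (∀ z, G (c t) (a t) z = - fderiv ℝ G (c t) (w t) (w t) z
          + fderiv ℝ G (c t) z (w t) (w t) / 2) ∧ ‖w t‖ ≤ κ ∧ ‖c t - x‖ ≤ κ) →
      (∀ t ∈ Icc (0 : ℝ) 1, G (c t) (w t) (w t) = G (c 0) (w 0) (w 0)) ∧
      ∀ (ζ : ℝ → E) (T : ℝ), ContinuousOn ζ (Icc 0 1) → (∀ t ∈ Icc (0 : ℝ) 1, ‖ζ t - x‖ ≤ κ) →
        ζ 0 = c 0 → ζ 1 = c 1 →
        (∀ t ∈ Ico (0 : ℝ) 1, ∃ v, HasDerivWithinAt ζ v (Ici t) t ∧ G (ζ t) v v ≤ T) →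
        G (c 0) (w 0) (w 0) ≤ T := by
  have hG1 : ContDiffAt ℝ 1 (fderiv ℝ G) x := hG.fderiv_right (by norm_num)
  obtain ⟨m, hm, hcoer⟩ := exists_eventually_coercive hG.continuousAt hpos
  obtain ⟨K₁, s₁, hs₁, hL₁⟩ := (hG.of_le (by norm_num : (1 : WithTop ℕ∞) ≤ 2)).exists_lipschitzOnWith
  obtain ⟨K₂, s₂, hs₂, hL₂⟩ := hG1.exists_lipschitzOnWith
  have hd : ∀ᶠ z in 𝓝 x, DifferentiableAt ℝ G z :=
    (hG.eventually (by simp)).mono fun z hz ↦ hz.differentiableAt (by simp)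
  obtain ⟨r, hr, hball⟩ := Metric.mem_nhds_iff.1
    (inter_mem (inter_mem hs₁ hs₂) (inter_mem hU (hcoer.and hd)))
  set C : ℝ := K₁ + K₂ + ‖G x‖
  have hK₁ : (0 : ℝ) ≤ K₁ := K₁.2
  have hK₂ : (0 : ℝ) ≤ K₂ := K₂.2
  have hGx := norm_nonneg (G x)
  have hC : 0 ≤ C := by positivity
  obtain ⟨κ, hκ, hκr, hκm⟩ : ∃ κ > 0, κ < r ∧ κ * (4 * C ^ 2 + m * C) ≤ m ^ 2 := by
    refine ⟨min (r / 2) (m ^ 2 / (4 * C ^ 2 + m * C + 1)), by positivity,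
      (min_le_left _ _).trans_lt (half_lt_self hr), ?_⟩
    calc _ ≤ (m ^ 2 / (4 * C ^ 2 + m * C + 1)) * (4 * C ^ 2 + m * C + 1) := by
          have : 0 ≤ 4 * C ^ 2 + m * C := by positivity
          exact mul_le_mul (min_le_right _ _) (by linarith) this (by positivity)
      _ = m ^ 2 := by field_simp
  have hsub : Metric.closedBall x κ ⊆ Metric.ball x r := Metric.closedBall_subset_ball hκr
  refine ⟨κ, hκ, fun z hz ↦ (hball (hsub hz)).2.1, fun c w a hcw ↦ ?_⟩
  have hmem (z : E) (hz : ‖z - x‖ ≤ κ) : z ∈ Metric.closedBall x κ := mem_closedBall_iff_norm.2 hz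
  have hGd (z : E) (hz : ‖z - x‖ ≤ κ) : HasFDerivAt G (fderiv ℝ G z) z :=
    (hball (hsub (hmem z hz))).2.2.2.hasFDerivAt
  have hnhds {t : ℝ} (ht : t ∈ Ico (0 : ℝ) 1) : Icc (0 : ℝ) 1 ∈ 𝓝[Ici t] t :=
    Icc_mem_nhdsGE_of_mem ht
  have hright {f : ℝ → E} {f' : E} {t : ℝ} (ht : t ∈ Ico (0 : ℝ) 1)
      (h : HasDerivWithinAt f f' (Icc 0 1) t) : HasDerivWithinAt f f' (Ici t) t :=
    h.mono_of_mem_nhdsWithin (hnhds ht)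
  have hIcc {t : ℝ} (ht : t ∈ Ico (0 : ℝ) 1) : t ∈ Icc (0 : ℝ) 1 := Ico_subset_Icc_self ht
  have hspeed : ∀ t ∈ Icc (0 : ℝ) 1, G (c t) (w t) (w t) = G (c 0) (w 0) (w 0) := by
    have hder (t : ℝ) (ht : t ∈ Icc (0 : ℝ) 1) :
        HasDerivWithinAt (fun s ↦ G (c s) (w s) (w s)) 0 (Icc 0 1) t := by
      obtain ⟨h1, h2, h3, -, h5⟩ := hcw t ht
      refine (hasDerivWithinAt_bilin (hGd _ h5) h1 h2 h2).congr_deriv ?_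
      rw [hsymm (c t) (w t) (a t), h3]
      ring
    exact constant_of_derivWithin_zero (fun t ht ↦ (hder t ht).differentiableWithinAt)
      fun t ht ↦ (hder t (hIcc ht)).derivWithin (uniqueDiffOn_Icc_zero_one t (hIcc ht))
  refine ⟨hspeed, fun ζ T hζc hζb hζ0 hζ1 hζ ↦ ?_⟩
  choose! ζ' hζ' using hζ
  set H : ℝ → ℝ := fun t ↦ 2 * G (c t) (w t) (ζ t - c t) - κ * t * G x (ζ t - c t) (ζ t - c t)
  have hcc : ContinuousOn c (Icc 0 1) := fun t ht ↦ (hcw t ht).1.continuousWithinAt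
  have hwc : ContinuousOn w (Icc 0 1) := fun t ht ↦ (hcw t ht).2.1.continuousWithinAt
  have hGc : ContinuousOn (fun t ↦ G (c t)) (Icc 0 1) := fun t ht ↦
    (hGd _ (hcw t ht).2.2.2.2).continuousAt.comp_continuousWithinAt (hcc t ht)
  have hηc : ContinuousOn (fun t ↦ ζ t - c t) (Icc 0 1) := hζc.sub hcc
  have hHc : ContinuousOn H (Icc 0 1) :=
    (continuousOn_const.mul ((hGc.clm_apply hwc).clm_apply hηc)).sub
      ((continuousOn_const.mul continuousOn_id).mul
        ((continuousOn_const.clm_apply hηc).clm_apply hηc))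
  have hH' (t : ℝ) (ht : t ∈ Ico (0 : ℝ) 1) : HasDerivWithinAt H
      (2 * (fderiv ℝ G (c t) (w t) (w t) (ζ t - c t) + G (c t) (a t) (ζ t - c t)
          + G (c t) (w t) (ζ' t - w t))
        - (κ * G x (ζ t - c t) (ζ t - c t) + κ * t * (0 + G x (ζ' t - w t) (ζ t - c t)
          + G x (ζ t - c t) (ζ' t - w t)))) (Ici t) t := by
    obtain ⟨h1, h2, -, -, h5⟩ := hcw t (hIcc ht)
    have hη := (hζ' t ht).1.sub (hright ht h1)
    have h6 := hasDerivWithinAt_bilin (hGd _ h5) (hright ht h1) (hright ht h2) hη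
    have h7 := hasDerivWithinAt_bilin (G := fun _ ↦ G x) (hasFDerivAt_const (G x) (c t))
      (hright ht h1) hη hη
    have h8 : HasDerivWithinAt (fun t ↦ κ * t) κ (Ici t) t := by
      simpa using (hasDerivWithinAt_id t (Ici t)).const_mul κ
    exact (h6.const_mul 2).sub (h8.mul h7)
  have hbound (t : ℝ) (ht : t ∈ Ico (0 : ℝ) 1) :
      2 * (fderiv ℝ G (c t) (w t) (w t) (ζ t - c t) + G (c t) (a t) (ζ t - c t)
          + G (c t) (w t) (ζ' t - w t))
        - (κ * G x (ζ t - c t) (ζ t - c t) + κ * t * (0 + G x (ζ' t - w t) (ζ t - c t)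
          + G x (ζ t - c t) (ζ' t - w t))) ≤ T - G (c 0) (w 0) (w 0) := by
    obtain ⟨-, -, h3, h4, h5⟩ := hcw t (hIcc ht)
    have hb := hball (hsub (hmem _ (hζb t (hIcc ht))))
    have hb' := hball (hsub (hmem _ h5))
    have hbx := hball (Metric.mem_ball_self hr)
    have hL : ‖G (ζ t) - G (c t)‖ ≤ C * ‖ζ t - c t‖ :=
      (hL₁.norm_sub_le hb.1.1 hb'.1.1).trans (by gcongr; simp only [C]; linarith)
    have hT : ‖G (ζ t) - G (c t) - fderiv ℝ G (c t) (ζ t - c t)‖ ≤ C * ‖ζ t - c t‖ ^ 2 :=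
      norm_sub_sub_fderiv_le (convex_ball x r) (fun z hz ↦ (hball hz).2.2.2)
        (fun z hz z' hz' ↦ (hL₂.norm_sub_le (hball hz).1.2 (hball hz').1.2).trans
          (by gcongr; simp only [C]; linarith)) hC (hsub (hmem _ h5))
          (hsub (hmem _ (hζb t (hIcc ht))))
    have key := energy_remainder_nonneg (h := ζ' t - w t) hm hκ.le hC hκm ht.1 ht.2.le h4 hL hT
      (by simp only [C]; linarith) hb.2.2.1 hbx.2.2.1
    have h6 := (hζ' t ht).2
    have h7 : ζ' t = w t + (ζ' t - w t) := by abel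
    rw [h7] at h6
    rw [← hspeed t (hIcc ht), h3, hsymm x (ζ' t - w t) (ζ t - c t)]
    generalize ζ' t - w t = h at *
    simp only [sub_apply, map_add, add_apply] at key h6
    rw [hsymm (ζ t) h (w t)] at h6
    linarith
  have hfin := image_le_of_deriv_right_le_deriv_boundary hHc hH'
    (B := fun t ↦ (T - G (c 0) (w 0) (w 0)) * t) (B' := fun _ ↦ T - G (c 0) (w 0) (w 0))
    (by simp [H, hζ0]) (by fun_prop)
    (fun t _ ↦ by simpa using (hasDerivWithinAt_id t (Ici t)).const_mul _) hbound
    (right_mem_Icc.2 zero_le_one)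
  have hH1 : H 1 = 0 := by simp [H, hζ1]
  rw [hH1] at hfin
  linarith

end Minimality

/-! ### Slow curves and escape times -/

section Escape

variable {E : Type*} [NormedAddCommGroup E] [NormedSpace ℝ E] [FiniteDimensional ℝ E]
  {M : Type*} [TopologicalSpace M] [ChartedSpace E M] [IsManifold 𝓘(ℝ, E) ∞ M]
  {g : RiemMetric E M}

/-- In the chart `e` the curve `σ` has, at the time `t`, a right derivative of length at most one. -/
def IsSlowIn (g : RiemMetric E M) (e : OpenPartialHomeomorph M E) (σ : ℝ → M) (t : ℝ) : Prop :=
  ∃ v : E, HasDerivWithinAt (fun s ↦ e (σ s)) v (Ici t) t ∧ localRep g.inner e (e (σ t)) v v ≤ 1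

/-- The curve `σ` has, at the time `t`, a right derivative of length at most one. -/
def IsSlowAt (g : RiemMetric E M) (σ : ℝ → M) (t : ℝ) : Prop :=
  ContinuousWithinAt σ (Ici t) t ∧ IsSlowIn g (chartAt E (σ t)) σ t

theorem IsSlowIn.change {e e' : OpenPartialHomeomorph M E} {σ : ℝ → M} {t : ℝ}
    (he : e ∈ IsManifold.maximalAtlas 𝓘(ℝ, E) ∞ M) (he' : e' ∈ IsManifold.maximalAtlas 𝓘(ℝ, E) ∞ M)
    (hc : ContinuousWithinAt σ (Ici t) t) (hs : σ t ∈ e.source) (hs' : σ t ∈ e'.source)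
    (h : IsSlowIn g e σ t) : IsSlowIn g e' σ t := by
  obtain ⟨v, hv, hv1⟩ := h
  have hy : e (σ t) ∈ (e.symm ≫ₕ e').source := by simp [e.map_source hs, e.left_inv hs, hs']
  have hτ : HasFDerivAt (e' ∘ e.symm) (fderiv ℝ (e' ∘ e.symm) (e (σ t))) (e (σ t)) :=
    (((contDiffOn_transition he he').contDiffAt
      ((e.symm ≫ₕ e').open_source.mem_nhds hy)).differentiableAt (by simp)).hasFDerivAt
  refine ⟨fderiv ℝ (e' ∘ e.symm) (e (σ t)) v, ?_, ?_⟩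
  · refine (hτ.comp_hasDerivWithinAt t hv).congr_of_eventuallyEq ?_ (by simp [e.left_inv hs])
    filter_upwards [hc (e.open_source.mem_nhds hs)] with s hs
    simp [e.left_inv hs]
  · have h1 := localRep_comp g.inner he he' hy v v
    rw [e.left_inv hs] at h1
    rwa [← h1]

theorem IsSlowAt.isSlowIn {σ : ℝ → M} {t : ℝ} (h : IsSlowAt g σ t) {e : OpenPartialHomeomorph M E}
    (he : e ∈ IsManifold.maximalAtlas 𝓘(ℝ, E) ∞ M) (hs : σ t ∈ e.source) : IsSlowIn g e σ t :=
  h.2.change (IsManifold.chart_mem_maximalAtlas _) he h.1 (mem_chart_source E _) hs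

theorem IsSlowIn.isSlowAt {σ : ℝ → M} {t : ℝ} {e : OpenPartialHomeomorph M E}
    (h : IsSlowIn g e σ t) (he : e ∈ IsManifold.maximalAtlas 𝓘(ℝ, E) ∞ M)
    (hc : ContinuousWithinAt σ (Ici t) t) (hs : σ t ∈ e.source) : IsSlowAt g σ t :=
  ⟨hc, h.change he (IsManifold.chart_mem_maximalAtlas _) hc hs (mem_chart_source E _)⟩

/-- The one-sided alternative serves the junction of two curves, where only the right half agrees.
-/
theorem IsSlowAt.congr {σ σ' : ℝ → M} {t : ℝ} (h : IsSlowAt g σ t) (heq : EqOn σ' σ (Ici t)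
    ∨ σ' =ᶠ[𝓝 t] σ) : IsSlowAt g σ' t := by
  have hev : σ' =ᶠ[𝓝[≥] t] σ :=
    heq.elim (fun h ↦ h.eventuallyEq_nhdsWithin) fun h ↦ h.filter_mono nhdsWithin_le_nhds
  have ht : σ' t = σ t := hev.self_of_nhdsWithin self_mem_Ici
  refine ⟨h.1.congr_of_eventuallyEq hev ht, ?_⟩
  obtain ⟨v, hv, hv1⟩ := h.2
  rw [ht]
  refine ⟨v, hv.congr_of_eventuallyEq ?_ (by rw [ht]), by rwa [ht]⟩
  exact hev.fun_comp (chartAt E (σ t))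

theorem IsSlowAt.comp_add_const {σ : ℝ → M} {t a : ℝ} (h : IsSlowAt g σ (t + a)) :
    IsSlowAt g (fun s ↦ σ (s + a)) t := by
  have hm : MapsTo (fun s : ℝ ↦ s + a) (Ici t) (Ici (t + a)) := fun s hs ↦
    add_le_add_left (mem_Ici.1 hs) a
  refine ⟨ContinuousWithinAt.comp (g := σ) (f := fun s : ℝ ↦ s + a) h.1
    (by fun_prop : Continuous fun s : ℝ ↦ s + a).continuousWithinAt hm, ?_⟩
  obtain ⟨v, hv, hv1⟩ := h.2
  refine ⟨v, ?_, hv1⟩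
  have h2 : HasDerivWithinAt (fun s : ℝ ↦ s + a) 1 (Ici t) t :=
    (hasDerivWithinAt_id t (Ici t)).add_const a
  have h3 : HasDerivWithinAt (fun s ↦ chartAt E (σ (t + a)) (σ (s + a))) ((1 : ℝ) • v) (Ici t) t :=
    HasDerivWithinAt.scomp (g₁ := fun s ↦ chartAt E (σ (t + a)) (σ s)) t hv h2 hm
  rwa [one_smul] at h3

/-- The factor `k` may be negative, so that a curve can also be run backwards. -/
theorem IsMagneticCurve.isSlowAt {F : MagneticField E M} {γ : ℝ → M} {J : Set ℝ}
    (h : IsMagneticCurve g F γ J) {a k s : ℝ} (hs : a + k * s ∈ J)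
    (hk : k ^ 2 * speedSq g γ (a + k * s) ≤ 1) : IsSlowAt g (fun s ↦ γ (a + k * s)) s := by
  have he : chartAt E (γ (a + k * s)) ∈ IsManifold.maximalAtlas 𝓘(ℝ, E) ∞ M :=
    IsManifold.chart_mem_maximalAtlas _
  have hsrc := mem_chart_source E (γ (a + k * s))
  have hd := h.hasDerivAt_coord_fst he hs hsrc
  have hl : HasDerivAt (fun s ↦ a + k * s) k s := by
    simpa using ((hasDerivAt_id s).const_mul k).const_add a
  have hd2 : HasDerivAt (fun u ↦ chartAt E (γ (a + k * s)) (γ (a + k * u))) (k • _) s :=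
    HasDerivAt.scomp (g₁ := fun u ↦ chartAt E (γ (a + k * s)) (γ u)) s hd hl
  refine ⟨(ContinuousAt.comp (g := γ) (f := fun s : ℝ ↦ a + k * s)
    (h.contMDiffAt hs).continuousAt hl.continuousAt).continuousWithinAt, _,
    hd2.hasDerivWithinAt, ?_⟩
  simp only [map_smul, smul_apply, smul_eq_mul]
  rw [← speedSq_eq_localRep g he ((h.contMDiffAt hs).mdifferentiableAt (by simp)) hsrc]
  linarith

/-- There is a slow curve issuing from `x` that leaves, within the time `b`, every compact set
for good or returns to it only to leave it again. -/
def Escapes (g : RiemMetric E M) (x : M) (b : ℝ) : Prop :=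
  ∃ σ : ℝ → M, 0 < b ∧ σ 0 = x ∧ ContinuousOn σ (Ico 0 b) ∧ (∀ t ∈ Ico 0 b, IsSlowAt g σ t) ∧
    ∀ K : Set M, IsCompact K → ∀ s ∈ Ico 0 b, ∃ t ∈ Ico s b, σ t ∉ K

theorem Escapes.pos {x : M} {b : ℝ} (h : Escapes g x b) : 0 < b := by
  obtain ⟨σ, hb, -⟩ := h
  exact hb

theorem escapes_tail {σ : ℝ → M} {b t₀ : ℝ} (hc : ContinuousOn σ (Ico 0 b))
    (hσ : ∀ t ∈ Ico 0 b, IsSlowAt g σ t)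
    (hK : ∀ K : Set M, IsCompact K → ∀ s ∈ Ico 0 b, ∃ t ∈ Ico s b, σ t ∉ K) (ht₀ : t₀ ∈ Ico 0 b) :
    Escapes g (σ t₀) (b - t₀) := by
  have hm {s : ℝ} (hs : s ∈ Ico 0 (b - t₀)) : s + t₀ ∈ Ico 0 b :=
    ⟨add_nonneg hs.1 ht₀.1, by linarith [hs.2]⟩
  refine ⟨fun s ↦ σ (s + t₀), sub_pos.2 ht₀.2, by simp, ?_, fun t ht ↦ ?_, fun K hKc s hs ↦ ?_⟩
  · exact hc.comp (by fun_prop) fun s hs ↦ hm hs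
  · exact (hσ _ (hm ht)).comp_add_const
  · obtain ⟨t, ht, htK⟩ := hK K hKc _ (hm hs)
    exact ⟨t - t₀, ⟨by linarith [ht.1], by linarith [ht.2]⟩, by simpa using htK⟩

/-- A corner at the junction is harmless, since slowness concerns the right derivative only, and
there it is that of the second curve. -/
theorem Escapes.prepend {ζ : ℝ → M} {τ b : ℝ} (hτ : 0 ≤ τ) (hc : ContinuousOn ζ (Icc 0 τ))
    (hζ : ∀ t ∈ Ico 0 τ, IsSlowAt g ζ t) (h : Escapes g (ζ τ) b) : Escapes g (ζ 0) (τ + b) := by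
  obtain ⟨σ, hb, hσ0, hσc, hσ, hK⟩ := h
  set ρ : ℝ → M := fun t ↦ if t < τ then ζ t else σ (t - τ) with hρ
  have h1 {t : ℝ} (ht : τ ≤ t) : ρ t = σ (t - τ) := if_neg ht.not_gt
  have h2 {t : ℝ} (ht : t ≤ τ) : ρ t = ζ t := by
    rcases ht.lt_or_eq with h | rfl
    · exact if_pos h
    · rw [h1 le_rfl, sub_self, hσ0]
  refine ⟨ρ, by linarith, h2 hτ, ?_, fun t ht ↦ ?_, fun K hKc s hs ↦ ?_⟩
  · refine ContinuousOn.if (fun t ht ↦ ?_) (hc.mono fun t ht ↦ ?_) (hσc.comp (by fun_prop) ?_)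
    · have : t = τ := by simpa using frontier_lt_subset_eq continuous_id continuous_const ht.2
      rw [this, sub_self, hσ0]
    · have : t ≤ τ := closure_lt_subset_le continuous_id continuous_const ht.2
      exact ⟨ht.1.1, this⟩
    · intro t ht
      have : τ ≤ t := closure_minimal (t := Ici τ) (fun u hu ↦ not_lt.1 hu) isClosed_Ici ht.2
      exact ⟨by linarith, by linarith [ht.1.2]⟩
  · rcases lt_or_ge t τ with htτ | htτ
    · refine (hζ t ⟨ht.1, htτ⟩).congr (Or.inr ?_)
      filter_upwards [Iio_mem_nhds htτ] with s hs
      exact h2 (le_of_lt hs)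
    · have h3 : IsSlowAt g σ (t + -τ) := hσ _ ⟨by linarith, by linarith [ht.2]⟩
      exact h3.comp_add_const.congr (Or.inl fun s hs ↦ h1 (htτ.trans hs))
  · obtain ⟨t, ht, htK⟩ := hK K hKc (max s τ - τ) ⟨by simp, by
      rw [sub_lt_iff_lt_add, max_lt_iff]
      exact ⟨by linarith [hs.2], by linarith⟩⟩
    have h4 := le_max_left s τ
    have h5 := le_max_right s τ
    refine ⟨t + τ, ⟨by linarith [ht.1], by linarith [ht.2]⟩, ?_⟩
    rw [h1 (by linarith [ht.1])]
    simpa using htK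

/-- The infimum of the times in which a slow curve can escape from `x`. -/
def escapeTime (g : RiemMetric E M) (x : M) : ℝ :=
  sInf {b | Escapes g x b}

theorem escapeTime_nonneg (g : RiemMetric E M) (x : M) : 0 ≤ escapeTime g x :=
  Real.sInf_nonneg fun _ hb ↦ hb.pos.le

theorem escapeTime_le {x : M} {b : ℝ} (h : Escapes g x b) : escapeTime g x ≤ b :=
  csInf_le ⟨0, fun _ hb ↦ hb.pos.le⟩ h

theorem exists_escapes_lt {x : M} (h : ∃ b, Escapes g x b) {ε : ℝ} (hε : 0 < ε) :
    ∃ b < escapeTime g x + ε, Escapes g x b := by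
  obtain ⟨b, hb, hlt⟩ := exists_lt_of_csInf_lt (s := {b | Escapes g x b}) h
    (lt_add_of_pos_right (escapeTime g x) hε)
  exact ⟨b, hlt, hb⟩

/-- The infimum of the empty set is 0 in ℝ, so `escapeTime` is meaningful only where some curve
escapes; that existence is therefore carried along with each inequality. -/
theorem escapeTime_le_add {x y : M} {τ : ℝ} (hy : ∃ b, Escapes g y b)
    (h : ∀ b, Escapes g y b → Escapes g x (τ + b)) :
    (∃ b, Escapes g x b) ∧ escapeTime g x ≤ τ + escapeTime g y := by
  obtain ⟨b, hb⟩ := hy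
  refine ⟨⟨_, h b hb⟩, le_of_forall_pos_le_add fun ε hε ↦ ?_⟩
  obtain ⟨b', hlt, hb'⟩ := exists_escapes_lt ⟨b, hb⟩ hε
  linarith [escapeTime_le (h b' hb')]

theorem IsGeodesic.escapeTime_le {η : ℝ → M} (hη : IsGeodesic g η univ)
    (h1 : speedSq g η 0 = 1) (s t : ℝ) (ht : ∃ b, Escapes g (η t) b) :
    (∃ b, Escapes g (η s) b) ∧ escapeTime g (η s) ≤ |s - t| + escapeTime g (η t) := by
  rw [isGeodesic_iff] at hη
  obtain ⟨k, hk, hkk⟩ : ∃ k : ℝ, k ^ 2 = 1 ∧ k * |s - t| = t - s := by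
    rcases le_total s t with hst | hst
    · exact ⟨1, by norm_num, by rw [abs_of_nonpos (by linarith)]; ring⟩
    · exact ⟨-1, by norm_num, by rw [abs_of_nonneg (by linarith)]; ring⟩
  refine escapeTime_le_add ht fun b hb ↦ ?_
  have hslow (u : ℝ) : IsSlowAt g (fun u ↦ η (s + k * u)) u :=
    hη.isSlowAt (mem_univ _) (by rw [hk, hη.speedSq_eq (mem_univ _) (mem_univ 0), h1, one_mul])
  have hcont : Continuous η := continuous_iff_continuousAt.2 fun u ↦
    (hη.contMDiffAt (mem_univ u)).continuousAt
  have := Escapes.prepend (g := g) (ζ := fun u ↦ η (s + k * u)) (abs_nonneg (s - t))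
    (hcont.comp (by fun_prop)).continuousOn (fun u _ ↦ hslow u) (b := b)
    (by simpa [hkk] using hb)
  simpa using this

theorem escapes_segment {e : OpenPartialHomeomorph M E}
    (he : e ∈ IsManifold.maximalAtlas 𝓘(ℝ, E) ∞ M) {P Q : E} (hPQ : segment ℝ P Q ⊆ e.target)
    {τ : ℝ} (hτ : 0 < τ)
    (hG : ∀ z ∈ segment ℝ P Q, localRep g.inner e z (Q - P) (Q - P) ≤ τ ^ 2) {b : ℝ}
    (h : Escapes g (e.symm Q) b) : Escapes g (e.symm P) (τ + b) := by
  have hmem {t : ℝ} (ht : t ∈ Icc 0 τ) : P + (t / τ) • (Q - P) ∈ segment ℝ P Q := by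
    rw [segment_eq_image']
    exact ⟨t / τ, ⟨div_nonneg ht.1 hτ.le, div_le_one_of_le₀ ht.2 hτ.le⟩, rfl⟩
  have hd (t : ℝ) : HasDerivAt (fun t ↦ P + (t / τ) • (Q - P)) ((1 / τ) • (Q - P)) t :=
    (((hasDerivAt_id t).div_const τ).smul_const (Q - P)).const_add P
  have hcont {t : ℝ} (ht : t ∈ Icc 0 τ) :
      ContinuousAt (fun t ↦ e.symm (P + (t / τ) • (Q - P))) t :=
    ContinuousAt.comp (g := e.symm) (f := fun t : ℝ ↦ P + (t / τ) • (Q - P))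
      (e.symm.continuousAt (hPQ (hmem ht))) (hd t).continuousAt
  have key := Escapes.prepend (g := g) (ζ := fun t ↦ e.symm (P + (t / τ) • (Q - P))) hτ.le
    (fun t ht ↦ (hcont ht).continuousWithinAt) (fun t ht ↦ ?_) (b := b)
    (by simpa [hτ.ne'] using h)
  · simpa using key
  have ht' : t ∈ Icc 0 τ := Ico_subset_Icc_self ht
  have hz := hPQ (hmem ht')
  refine IsSlowIn.isSlowAt (e := e) ⟨(1 / τ) • (Q - P), ?_, ?_⟩ he (hcont ht').continuousWithinAt
    (e.map_target hz)
  · refine ((hd t).congr_of_eventuallyEq ?_).hasDerivWithinAt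
    filter_upwards [(hd t).continuousAt (e.open_target.mem_nhds hz)] with s hs
    exact e.right_inv hs
  · rw [e.right_inv hz]
    have := hG _ (hmem ht')
    simp only [map_smul, smul_apply, smul_eq_mul]
    rw [← mul_assoc, ← sq, div_pow, one_pow, one_div, ← div_eq_inv_mul]
    exact div_le_one_of_le₀ this (by positivity)

end Escape

/-! ### Geodesics along which the escape time decreases at unit rate -/

section Descent

variable {E : Type*} [NormedAddCommGroup E] [NormedSpace ℝ E] [FiniteDimensional ℝ E]
  {M : Type*} [TopologicalSpace M] [ChartedSpace E M] [IsManifold 𝓘(ℝ, E) ∞ M]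
  {g : RiemMetric E M}

/-- The closed coordinate ball is compact, so σ has to leave it; the time sought is the first one
outside the open ball. The point reached lies in the closure of the compact set `K`, hence in `K`
because `M` is Hausdorff, and so is still in the chart. -/
theorem exists_first_crossing [T2Space M] {σ : ℝ → M} {b ρ : ℝ} (hb : 0 < b) (hρ : 0 < ρ)
    (hc : ContinuousOn σ (Ico 0 b))
    (hK : ∀ K : Set M, IsCompact K → ∀ s ∈ Ico 0 b, ∃ t ∈ Ico s b, σ t ∉ K)
    {e : OpenPartialHomeomorph M E} (h0 : σ 0 ∈ e.source)
    (hball : Metric.closedBall (e (σ 0)) ρ ⊆ e.target) :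
    ∃ t ∈ Ioo 0 b, (∀ s ∈ Icc 0 t, σ s ∈ e.source ∧ ‖e (σ s) - e (σ 0)‖ ≤ ρ) ∧
      ‖e (σ t) - e (σ 0)‖ = ρ := by
  set K : Set M := e.symm '' Metric.closedBall (e (σ 0)) ρ
  have hKc : IsCompact K := (isCompact_closedBall _ _).image_of_continuousOn
    (e.continuousOn_symm.mono hball)
  set O : Set M := e.source ∩ e ⁻¹' Metric.ball (e (σ 0)) ρ
  have hO : IsOpen O := e.isOpen_inter_preimage Metric.isOpen_ball
  have hOK : O ⊆ K := fun z hz ↦ ⟨e z, Metric.ball_subset_closedBall hz.2, e.left_inv hz.1⟩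
  have h0O : σ 0 ∈ O := ⟨h0, Metric.mem_ball_self hρ⟩
  obtain ⟨t₁, ht₁, ht₁K⟩ := hK K hKc 0 ⟨le_rfl, hb⟩
  have hsub : Icc 0 t₁ ⊆ Ico 0 b := fun s hs ↦ ⟨hs.1, hs.2.trans_lt ht₁.2⟩
  set Z : Set ℝ := Icc 0 t₁ ∩ σ ⁻¹' Oᶜ
  have hZc : IsClosed Z :=
    (hc.mono hsub).preimage_isClosed_of_isClosed isClosed_Icc hO.isClosed_compl
  have hZb : BddBelow Z := ⟨0, fun s hs ↦ hs.1.1⟩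
  have htZ : sInf Z ∈ Z := hZc.csInf_mem ⟨t₁, ⟨ht₁.1, le_rfl⟩, fun h ↦ ht₁K (hOK h)⟩ hZb
  set t := sInf Z
  have ht0 : 0 < t := htZ.1.1.lt_of_ne fun h ↦ htZ.2 (h ▸ h0O)
  have hlt (s : ℝ) (hs : s ∈ Ico 0 t) : σ s ∈ O := by
    by_contra hsO
    exact (csInf_le hZb ⟨⟨hs.1, hs.2.le.trans htZ.1.2⟩, hsO⟩).not_gt hs.2
  have htK : σ t ∈ K := by
    have h1 : ContinuousWithinAt σ (Ico 0 t) t :=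
      (hc t (hsub htZ.1)).mono fun s hs ↦ hsub ⟨hs.1, hs.2.le.trans htZ.1.2⟩
    have h2 := h1.mem_closure (by rw [closure_Ico ht0.ne]; exact right_mem_Icc.2 ht0.le)
      (t := K) fun s hs ↦ hOK (hlt s hs)
    rwa [hKc.isClosed.closure_eq] at h2
  obtain ⟨y, hy, hyt⟩ := htK
  have hys : σ t ∈ e.source := hyt ▸ e.map_target (hball hy)
  have hey : e (σ t) = y := by rw [← hyt, e.right_inv (hball hy)]
  have hle : ‖e (σ t) - e (σ 0)‖ ≤ ρ := by rw [hey]; exact mem_closedBall_iff_norm.1 hy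
  refine ⟨t, ⟨ht0, (hsub htZ.1).2⟩, fun s hs ↦ ?_, hle.antisymm (not_lt.1 fun h ↦ htZ.2
    ⟨hys, mem_ball_iff_norm.2 h⟩)⟩
  rcases hs.2.lt_or_eq with h | rfl
  · have := hlt s ⟨hs.1, h⟩
    exact ⟨this.1, (mem_ball_iff_norm.1 this.2).le⟩
  · exact ⟨hys, hle⟩

/-- The coordinate segment from `P` to `Q` is a slow curve of duration proportional to ‖Q - P‖,
because the metric is bounded on the compact ball. -/
theorem exists_escapeTime_lipschitz {e : OpenPartialHomeomorph M E}
    (he : e ∈ IsManifold.maximalAtlas 𝓘(ℝ, E) ∞ M) {x : E} {ρ : ℝ}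
    (hball : Metric.closedBall x ρ ⊆ e.target) :
    ∃ L, ∀ P ∈ Metric.closedBall x ρ, ∀ Q ∈ Metric.closedBall x ρ,
      (∃ b, Escapes g (e.symm Q) b) → (∃ b, Escapes g (e.symm P) b) ∧
        escapeTime g (e.symm P) ≤ L * ‖Q - P‖ + escapeTime g (e.symm Q) := by
  obtain ⟨C, hC⟩ := (isCompact_closedBall x ρ).exists_bound_of_continuousOn
    ((contDiffOn_localRep_inner g he).continuousOn.mono hball)
  set L := max C 0 + 1
  have hL : 1 ≤ L := by linarith [le_max_right C 0]
  have hCL : C ≤ L ^ 2 := by nlinarith [le_max_left C 0]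
  refine ⟨L, fun P hP Q hQ hb ↦ ?_⟩
  rcases eq_or_ne P Q with rfl | hne
  · exact ⟨hb, by simp⟩
  have hn : 0 < ‖Q - P‖ := norm_pos_iff.2 (sub_ne_zero.2 hne.symm)
  have hseg : segment ℝ P Q ⊆ Metric.closedBall x ρ :=
    (convex_closedBall x ρ).segment_subset hP hQ
  refine escapeTime_le_add hb fun b hb ↦ ?_
  refine escapes_segment he (hseg.trans hball) (by positivity) (fun z hz ↦ ?_) hb
  have h1 : ‖localRep g.inner e z (Q - P) (Q - P)‖ ≤ C * ‖Q - P‖ * ‖Q - P‖ :=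
    (ContinuousLinearMap.le_opNorm₂ _ _ _).trans (by gcongr; exact hC z (hseg hz))
  calc _ ≤ C * ‖Q - P‖ * ‖Q - P‖ := (le_abs_self _).trans h1
    _ = C * ‖Q - P‖ ^ 2 := by ring
    _ ≤ L ^ 2 * ‖Q - P‖ ^ 2 := by gcongr
    _ = (L * ‖Q - P‖) ^ 2 := by ring

/-- Rescaled to unit speed, the curve is a geodesic on the open interval (0, ℓ). Completeness
extends that piece to ℝ, and the values at 0 and ℓ follow by continuity. -/
theorem GeodesicallyComplete.exists_geodesic_of_coord [T2Space M] (hg : GeodesicallyComplete g)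
    {e : OpenPartialHomeomorph M E} (he : e ∈ IsManifold.maximalAtlas 𝓘(ℝ, E) ∞ M) {c w : ℝ → E}
    (hcw : ∀ t ∈ Icc (0 : ℝ) 1, HasDerivWithinAt c (w t) (Icc 0 1) t ∧
      HasDerivWithinAt w (coordForce g (zeroField E M) e (c t, w t)) (Icc 0 1) t ∧ c t ∈ e.target)
    {ℓ : ℝ} (hℓ : 0 < ℓ)
    (hspeed : ∀ t ∈ Icc (0 : ℝ) 1, localRep g.inner e (c t) (w t) (w t) = ℓ ^ 2) :
    ∃ η : ℝ → M, IsGeodesic g η univ ∧ speedSq g η 0 = 1 ∧ η 0 = e.symm (c 0) ∧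
      η ℓ = e.symm (c 1) := by
  have hmem {s : ℝ} (hs : s ∈ Ioo 0 ℓ) : s / ℓ ∈ Ioo (0 : ℝ) 1 :=
    ⟨div_pos hs.1 hℓ, (div_lt_one hℓ).2 hs.2⟩
  have hmem' {s : ℝ} (hs : s ∈ Icc 0 ℓ) : s / ℓ ∈ Icc (0 : ℝ) 1 :=
    ⟨div_nonneg hs.1 hℓ.le, div_le_one_of_le₀ hs.2 hℓ.le⟩
  have hdiv (s : ℝ) : HasDerivAt (fun s ↦ s / ℓ) (1 / ℓ) s := (hasDerivAt_id s).div_const ℓ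
  have hc (s : ℝ) (hs : s ∈ Ioo 0 ℓ) :
      HasDerivAt (fun s ↦ c (s / ℓ)) ((1 / ℓ) • w (s / ℓ)) s :=
    HasDerivAt.scomp (g₁ := c) s ((hcw _ (Ioo_subset_Icc_self (hmem hs))).1.hasDerivAt
      (Icc_mem_nhds (hmem hs).1 (hmem hs).2)) (hdiv s)
  have hw (s : ℝ) (hs : s ∈ Ioo 0 ℓ) : HasDerivAt (fun s ↦ (1 / ℓ) • w (s / ℓ))
      (coordForce g (zeroField E M) e (c (s / ℓ), (1 / ℓ) • w (s / ℓ))) s := by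
    have h1 : HasDerivAt (fun s ↦ w (s / ℓ)) _ s :=
      HasDerivAt.scomp (g₁ := w) s ((hcw _ (Ioo_subset_Icc_self (hmem hs))).2.1.hasDerivAt
        (Icc_mem_nhds (hmem hs).1 (hmem hs).2)) (hdiv s)
    refine (h1.const_smul (1 / ℓ)).congr_deriv ?_
    rw [coordForce_zeroField, coordForce_zeroField]
    simp only [map_smul, smul_apply, smul_neg]
  have hgeo := isMagneticCurve_symm_comp g (zeroField E M) he (isOpenInterval_Ioo hℓ) hc hw
    fun s hs ↦ (hcw _ (Ioo_subset_Icc_self (hmem hs))).2.2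
  obtain ⟨η, hη, heq⟩ := hg.exists_extension ((isGeodesic_iff _ _ _).2 hgeo)
  have hη' := (isGeodesic_iff _ _ _).1 hη
  have hηc : Continuous η := continuous_iff_continuousAt.2 fun u ↦
    (hη'.contMDiffAt (mem_univ u)).continuousAt
  have hcc : ContinuousOn c (Icc 0 1) := fun t ht ↦ (hcw t ht).1.continuousWithinAt
  have hκ : ContinuousOn (fun s ↦ e.symm (c (s / ℓ))) (Icc 0 ℓ) :=
    e.continuousOn_symm.comp (hcc.comp (by fun_prop) fun s hs ↦ hmem' hs)
      fun s hs ↦ (hcw _ (hmem' hs)).2.2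
  have heq' : EqOn η (fun s ↦ e.symm (c (s / ℓ))) (Icc 0 ℓ) :=
    heq.of_subset_closure hηc.continuousOn hκ Ioo_subset_Icc_self (closure_Ioo hℓ.ne).ge
  refine ⟨η, hη, ?_, by simpa using heq' (left_mem_Icc.2 hℓ.le),
    by simpa [hℓ.ne'] using heq' (right_mem_Icc.2 hℓ.le)⟩
  have hs : ℓ / 2 ∈ Ioo 0 ℓ := ⟨by positivity, by linarith⟩
  have hct := (hcw _ (Ioo_subset_Icc_self (hmem hs))).2.2
  have hηs : η (ℓ / 2) ∈ e.source := by
    rw [heq hs]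
    exact e.map_target hct
  rw [hη'.speedSq_eq (mem_univ 0) (mem_univ (ℓ / 2)), speedSq_eq_localRep g he
    ((hη'.contMDiffAt (mem_univ _)).mdifferentiableAt (by simp)) hηs]
  have hev : (fun s ↦ e (η s)) =ᶠ[𝓝 (ℓ / 2)] fun s ↦ c (s / ℓ) :=
    eventually_of_mem (isOpen_Ioo.mem_nhds hs) fun s hs ↦ by
      simp only [heq hs]
      exact e.right_inv (hcw _ (Ioo_subset_Icc_self (hmem hs))).2.2
  have hpt : e (η (ℓ / 2)) = c (ℓ / 2 / ℓ) := hev.self_of_nhds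
  rw [hev.deriv_eq, (hc _ hs).deriv, hpt]
  simp only [map_smul, smul_apply, smul_eq_mul]
  rw [hspeed _ (Ioo_subset_Icc_self (hmem hs))]
  field_simp

theorem GeodesicallyComplete.exists_descent [T2Space M] (hg : GeodesicallyComplete g) {x : M}
    (hx : ∃ b, Escapes g x b) :
    ∃ η : ℝ → M, IsGeodesic g η univ ∧ speedSq g η 0 = 1 ∧ η 0 = x ∧
      ∃ δ > 0, (∃ b, Escapes g (η δ) b) ∧ δ + escapeTime g (η δ) ≤ escapeTime g x := by
  set e := chartAt E x
  have he : e ∈ IsManifold.maximalAtlas 𝓘(ℝ, E) ∞ M := IsManifold.chart_mem_maximalAtlas x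
  have hxs : x ∈ e.source := mem_chart_source E x
  have hxt : e x ∈ e.target := e.map_source hxs
  have htn : e.target ∈ 𝓝 (e x) := e.open_target.mem_nhds hxt
  obtain ⟨κ, hκ, hκt, hmin⟩ := exists_geodesic_minimizing
    (((contDiffOn_localRep_inner g he).contDiffAt htn).of_le (by norm_cast))
    (localRep_inner_symm g e) (fun v hv ↦ localRep_inner_pos g he hxt hv) htn
  obtain ⟨ρ, hρ, hρκ, c, w, hcw, hw0⟩ := exists_connecting_geodesics
    (((contDiffOn_christoffelL g he).contDiffAt htn).of_le (by norm_cast)) hκ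
  have hball : Metric.closedBall (e x) ρ ⊆ e.target :=
    (Metric.closedBall_subset_closedBall hρκ).trans hκt
  have hct (y : E) (hy : y ∈ Metric.closedBall (e x) ρ) (t : ℝ) (ht : t ∈ Icc (0 : ℝ) 1) :
      c y t ∈ e.target := hκt (mem_closedBall_iff_norm.2 ((hcw y hy).2.2 t ht).2.2.2)
  have hcw' (y : E) (hy : y ∈ Metric.closedBall (e x) ρ) (t : ℝ) (ht : t ∈ Icc (0 : ℝ) 1) :
      HasDerivWithinAt (w y) (coordForce g (zeroField E M) e (c y t, w y t)) (Icc 0 1) t := by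
    rw [coordForce_zeroField]
    exact ((hcw y hy).2.2 t ht).2.1
  have hmin' (y : E) (hy : y ∈ Metric.closedBall (e x) ρ) := hmin (c y) (w y)
    (fun t ↦ coordForce g (zeroField E M) e (c y t, w y t)) fun t ht ↦
      ⟨((hcw y hy).2.2 t ht).1, hcw' y hy t ht, fun z ↦ by
        have h0 : localRep (zeroField E M).form e (c y t) (w y t) z = 0 := rfl
        rw [localRep_coordForce g _ he (hct y hy t ht), h0]
        ring, ((hcw y hy).2.2 t ht).2.2.1, ((hcw y hy).2.2 t ht).2.2.2⟩
  -- The length of the geodesic to `y`, which has constant speed on the unit interval.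
  set ℓ : E → ℝ := fun y ↦ √(localRep g.inner e (e x) (w y 0) (w y 0)) with hℓ_def
  have hnn (v : E) : 0 ≤ localRep g.inner e (e x) v v := by
    rcases eq_or_ne v 0 with rfl | hv
    · simp
    · exact (localRep_inner_pos g he hxt hv).le
  have hsph : Metric.sphere (e x) ρ ⊆ Metric.closedBall (e x) ρ := Metric.sphere_subset_closedBall
  have hℓc : ContinuousOn ℓ (Metric.sphere (e x) ρ) := by
    have := hw0.mono hsph
    exact ((continuousOn_const.clm_apply this).clm_apply this).sqrt
  obtain ⟨L, hL⟩ := exists_escapeTime_lipschitz (g := g) he hball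
  have hxe : e.symm (e x) = x := e.left_inv hxs
  have hesc (y : E) (hy : y ∈ Metric.closedBall (e x) ρ) : ∃ b, Escapes g (e.symm y) b :=
    (hL y hy (e x) (Metric.mem_closedBall_self hρ.le) (hxe.symm ▸ hx)).1
  have hfc : ContinuousOn (fun y ↦ escapeTime g (e.symm y)) (Metric.sphere (e x) ρ) := by
    have : LipschitzOnWith L.toNNReal (fun y ↦ escapeTime g (e.symm y))
        (Metric.sphere (e x) ρ) := by
      refine LipschitzOnWith.of_le_add_mul' L fun P hP Q hQ ↦ ?_
      have := (hL P (hsph hP) Q (hsph hQ) (hesc Q (hsph hQ))).2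
      rw [dist_comm, dist_eq_norm]
      linarith
    exact this.continuousOn
  -- The escaping curve meets the sphere at a time t. Rescaled to the unit interval it has squared
  -- speed at most t², so minimality gives ℓ y ≤ t, and the rest of the curve escapes in the time b
  -- - t.
  have hcross {b : ℝ} (hb : Escapes g x b) : ∃ y ∈ Metric.sphere (e x) ρ,
      ℓ y + escapeTime g (e.symm y) ≤ b := by
    obtain ⟨σ, hb0, rfl, hσc, hσ, hK⟩ := hb
    obtain ⟨t, ht, hle, heq⟩ := exists_first_crossing hb0 hρ hσc hK hxs hball
    have hts := (hle t (right_mem_Icc.2 ht.1.le)).1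
    have hy : e (σ t) ∈ Metric.sphere (e (σ 0)) ρ := mem_sphere_iff_norm.2 heq
    have htail := escapeTime_le (escapes_tail hσc hσ hK (Ioo_subset_Ico_self ht))
    refine ⟨e (σ t), hy, ?_⟩
    rw [e.left_inv hts]
    suffices h : ℓ (e (σ t)) ≤ t by linarith
    refine Real.sqrt_le_iff.2 ⟨ht.1.le, ?_⟩
    have hm {u : ℝ} (hu : u ∈ Icc (0 : ℝ) 1) : t * u ∈ Icc 0 t :=
      ⟨mul_nonneg ht.1.le hu.1, mul_le_of_le_one_right ht.1.le hu.2⟩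
    have h1 := (hmin' _ (hsph hy)).2 (fun u ↦ e (σ (t * u))) (t ^ 2) ?_
      (fun u hu ↦ ((hle _ (hm hu)).2).trans hρκ) (by simp [(hcw _ (hsph hy)).1])
      (by simp [(hcw _ (hsph hy)).2.1]) fun u hu ↦ ?_
    · rwa [(hcw _ (hsph hy)).1] at h1
    · refine e.continuousOn.comp (hσc.comp (by fun_prop) fun u hu ↦ ?_)
        fun u hu ↦ (hle _ (hm hu)).1
      exact ⟨(hm hu).1, (hm hu).2.trans_lt ht.2⟩
    · have hu' := hm (Ico_subset_Icc_self hu)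
      obtain ⟨v, hv, hv1⟩ := (hσ (t * u) ⟨hu'.1, hu'.2.trans_lt ht.2⟩).isSlowIn he (hle _ hu').1
      have hlin : HasDerivWithinAt (fun u ↦ t * u) t (Ici u) u := by
        simpa using (hasDerivWithinAt_id u (Ici u)).const_mul t
      refine ⟨t • v, HasDerivWithinAt.scomp (g₁ := fun s ↦ e (σ s)) u hv hlin fun r hr ↦
        mul_le_mul_of_nonneg_left hr ht.1.le, ?_⟩
      simp only [map_smul, smul_apply, smul_eq_mul]
      nlinarith [sq_nonneg t]
  -- The crossing itself provides a point, so dimension zero needs no separate case.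
  have hne : (Metric.sphere (e x) ρ).Nonempty := by
    obtain ⟨b, hb⟩ := hx
    obtain ⟨y, hy, -⟩ := hcross hb
    exact ⟨y, hy⟩
  obtain ⟨y, hy, hymin⟩ := (isCompact_sphere (e x) ρ).exists_isMinOn hne (hℓc.add hfc)
  have hyle : ℓ y + escapeTime g (e.symm y) ≤ escapeTime g x := by
    refine le_of_forall_pos_le_add fun ε hε ↦ ?_
    obtain ⟨b, hlt, hb⟩ := exists_escapes_lt hx hε
    obtain ⟨z, hz, hzb⟩ := hcross hb
    exact (hymin hz).trans (hzb.trans hlt.le)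
  have hyb := hsph hy
  have hspeed : ∀ t ∈ Icc (0 : ℝ) 1, localRep g.inner e (c y t) (w y t) (w y t) = ℓ y ^ 2 := by
    intro t ht
    rw [(hmin' y hyb).1 t ht, (hcw y hyb).1, hℓ_def, Real.sq_sqrt (hnn _)]
  -- A geodesic of zero speed is constant, but its endpoints are at the distance ρ > 0.
  have hℓ0 : 0 < ℓ y := by
    refine (Real.sqrt_nonneg _ : 0 ≤ ℓ y).lt_of_ne fun h0 ↦ ?_
    have hw (t : ℝ) (ht : t ∈ Icc (0 : ℝ) 1) : w y t = 0 := by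
      by_contra hne
      have := localRep_inner_pos g he (hct y hyb t ht) hne
      have h0' : ℓ y = 0 := h0.symm
      rw [hspeed t ht, h0'] at this
      simp at this
    have hconst := constant_of_derivWithin_zero
      (fun t ht ↦ ((hcw y hyb).2.2 t ht).1.differentiableWithinAt) (fun t ht ↦ by
        have ht' := Ico_subset_Icc_self ht
        rw [((hcw y hyb).2.2 t ht').1.derivWithin (uniqueDiffOn_Icc_zero_one t ht'), hw t ht']) 1
      (right_mem_Icc.2 zero_le_one)
    rw [(hcw y hyb).1, (hcw y hyb).2.1] at hconst
    rw [hconst, Metric.mem_sphere, dist_self] at hy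
    exact hρ.ne hy
  obtain ⟨η, hη, hη1, hη0, hηℓ⟩ := hg.exists_geodesic_of_coord he
    (fun t ht ↦ ⟨((hcw y hyb).2.2 t ht).1, hcw' y hyb t ht, hct y hyb t ht⟩) hℓ0 hspeed
  rw [(hcw y hyb).1, hxe] at hη0
  rw [(hcw y hyb).2.1] at hηℓ
  exact ⟨η, hη, hη1, hη0, ℓ y, hℓ0, hηℓ ▸ hesc y hyb, hηℓ ▸ hyle⟩

end Descent

/-! ### Completeness excludes escape -/

section NoEscape

variable {E : Type*} [NormedAddCommGroup E] [NormedSpace ℝ E] [FiniteDimensional ℝ E]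
  {M : Type*} [TopologicalSpace M] [ChartedSpace E M] [IsManifold 𝓘(ℝ, E) ∞ M]
  {g : RiemMetric E M}

/-- Since Q u - P u = u (q' - p') + o(u), continuity of `G` at `q` carries the strict inequality to
all points of the short segment. -/
theorem eventually_segment_bilin_le {G : E → E →L[ℝ] E →L[ℝ] ℝ} {U : Set E} {P Q : ℝ → E}
    {q p' q' : E} {θ : ℝ} (hG : ContinuousAt G q) (hU : U ∈ 𝓝 q) (hP : HasDerivAt P p' 0)
    (hQ : HasDerivAt Q q' 0) (hP0 : P 0 = q) (hQ0 : Q 0 = q)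
    (hθ : G q (q' - p') (q' - p') < θ ^ 2) :
    ∀ᶠ u in 𝓝[>] (0 : ℝ), segment ℝ (P u) (Q u) ⊆ U ∧
      ∀ z ∈ segment ℝ (P u) (Q u), G z (Q u - P u) (Q u - P u) ≤ (θ * u) ^ 2 := by
  have h1 : ContinuousAt (fun p : E × E ↦ G p.1 p.2 p.2) (q, q' - p') :=
    ((ContinuousAt.comp (f := Prod.fst) (g := G) (x := (q, q' - p')) hG
      continuousAt_fst).clm_apply continuousAt_snd).clm_apply continuousAt_snd
  have h2 := h1.eventually (gt_mem_nhds hθ)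
  rw [nhds_prod_eq] at h2
  obtain ⟨p₁, hp₁, p₂, hp₂, hp⟩ := eventually_prod_iff.1 h2
  obtain ⟨r, hr, hball⟩ := Metric.mem_nhds_iff.1 (inter_mem hp₁ hU)
  have h3 : Tendsto (fun u ↦ u⁻¹ • (Q u - P u)) (𝓝[>] 0) (𝓝 (q' - p')) := by
    have := (hasDerivAt_iff_tendsto_slope_zero.1 (hQ.sub hP)).mono_left
      (nhdsGT_le_nhdsNE (0 : ℝ))
    simpa [hP0, hQ0] using this
  have hPb : ∀ᶠ u in 𝓝[>] (0 : ℝ), P u ∈ Metric.ball q r :=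
    (hP.continuousAt.tendsto.mono_left nhdsWithin_le_nhds).eventually
      (by rw [hP0]; exact Metric.ball_mem_nhds q hr)
  have hQb : ∀ᶠ u in 𝓝[>] (0 : ℝ), Q u ∈ Metric.ball q r :=
    (hQ.continuousAt.tendsto.mono_left nhdsWithin_le_nhds).eventually
      (by rw [hQ0]; exact Metric.ball_mem_nhds q hr)
  filter_upwards [hPb, hQb, h3.eventually hp₂, self_mem_nhdsWithin] with u hu1 hu2 hu3 hu0
  have hseg : segment ℝ (P u) (Q u) ⊆ Metric.ball q r := (convex_ball q r).segment_subset hu1 hu2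
  refine ⟨fun z hz ↦ (hball (hseg hz)).2, fun z hz ↦ ?_⟩
  have hlt := hp (hball (hseg hz)).1 hu3
  have hu0' : u ≠ 0 := (mem_Ioi.1 hu0).ne'
  simp only [map_smul, smul_apply, smul_eq_mul] at hlt
  calc G z (Q u - P u) (Q u - P u) = u ^ 2 * (u⁻¹ * (u⁻¹ * G z (Q u - P u) (Q u - P u))) := by
        field_simp
    _ ≤ u ^ 2 * θ ^ 2 := by gcongr
    _ = (θ * u) ^ 2 := by ring

/-- A geodesic along which the escape time decreases at unit rate continues smoothly by every
other such geodesic. -/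
theorem deriv_eq_of_escapeTime {η ξ : ℝ → M} (hη : IsGeodesic g η univ)
    (hη1 : speedSq g η 0 = 1) (hξ : IsGeodesic g ξ univ) (hξ1 : speedSq g ξ 0 = 1) {s δ : ℝ}
    (hs : 0 < s) (hδ : 0 < δ) (h0 : ξ 0 = η s) (hesc : ∃ b, Escapes g (ξ δ) b)
    (hle : s + (δ + escapeTime g (ξ δ)) ≤ escapeTime g (η 0))
    {e : OpenPartialHomeomorph M E} (he : e ∈ IsManifold.maximalAtlas 𝓘(ℝ, E) ∞ M)
    (hse : η s ∈ e.source) :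
    deriv (fun t ↦ e (η t)) s = deriv (fun t ↦ e (ξ t)) 0 := by
  have hη' := (isGeodesic_iff _ _ _).1 hη
  have hξ' := (isGeodesic_iff _ _ _).1 hξ
  have hse' : ξ 0 ∈ e.source := h0 ▸ hse
  have hq := e.map_source hse
  set q := e (η s) with hq_def
  have hqξ : e (ξ 0) = q := by rw [h0]
  set a := deriv (fun t ↦ e (η t)) s
  set b := deriv (fun t ↦ e (ξ t)) 0
  have ha : localRep g.inner e q a a = 1 := by
    rw [← speedSq_eq_localRep g he ((hη'.contMDiffAt (mem_univ s)).mdifferentiableAt (by simp)) hse,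
      hη'.speedSq_eq (mem_univ s) (mem_univ 0), hη1]
  have hb : localRep g.inner e q b b = 1 := by
    rw [← hqξ, ← speedSq_eq_localRep g he
      ((hξ'.contMDiffAt (mem_univ 0)).mdifferentiableAt (by simp)) hse', hξ1]
  -- For distinct unit vectors |a + b|² = 4 - |a - b|² < 4. So for small u the segment from η(s - u)
  -- to ξ(u) takes a time θ u with θ < 2, less than the time 2u through the corner.
  by_contra hne
  have hab := localRep_inner_pos g he hq (sub_ne_zero.2 hne)
  have hsym := localRep_inner_symm g e q a b
  have hlt : localRep g.inner e q (b - -a) (b - -a) < 2 ^ 2 := by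
    simp only [sub_neg_eq_add, map_add, map_sub, sub_apply, add_apply] at hab ⊢
    linarith
  obtain ⟨θ, hθ0, hθ2, hθ⟩ : ∃ θ > 0, θ < 2 ∧ localRep g.inner e q (b - -a) (b - -a) < θ ^ 2 := by
    have h1 : Tendsto (fun θ : ℝ ↦ θ ^ 2) (𝓝[<] 2) (𝓝 (2 ^ 2)) :=
      ((continuous_pow 2).tendsto 2).mono_left nhdsWithin_le_nhds
    have h2 : ∀ᶠ θ in 𝓝[<] (2 : ℝ), θ < 2 := self_mem_nhdsWithin
    have h3 : ∀ᶠ θ in 𝓝[<] (2 : ℝ), 0 < θ := nhdsWithin_le_nhds (lt_mem_nhds two_pos)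
    obtain ⟨θ, h1, h2, h3⟩ := ((h1.eventually (lt_mem_nhds hlt)).and (h2.and h3)).exists
    exact ⟨θ, h3, h2, h1⟩
  have hP : HasDerivAt (fun u ↦ e (η (s - u))) (-a) 0 := by
    have h1 := hη'.hasDerivAt_coord_fst he (mem_univ s) hse
    have h2 : HasDerivAt (fun u : ℝ ↦ s - u) (-1) 0 := by
      simpa using (hasDerivAt_id (0 : ℝ)).const_sub s
    have h3 : HasDerivAt (fun u ↦ e (η (s - u))) ((-1 : ℝ) • a) 0 :=
      HasDerivAt.scomp (g₁ := fun u ↦ e (η u)) 0 (by rwa [sub_zero]) h2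
    simpa using h3
  have hQ := hξ'.hasDerivAt_coord_fst he (mem_univ 0) hse'
  have hev := eventually_segment_bilin_le (((contDiffOn_localRep_inner g he).contDiffAt
    (e.open_target.mem_nhds hq)).continuousAt) (e.open_target.mem_nhds hq) hP hQ (by simp [q])
    hqξ hθ
  have hevη : ∀ᶠ u in 𝓝[>] (0 : ℝ), η (s - u) ∈ e.source := by
    have : ContinuousAt (fun u ↦ η (s - u)) 0 := ContinuousAt.comp (g := η)
      (f := fun u : ℝ ↦ s - u) (by simpa using (hη'.contMDiffAt (mem_univ s)).continuousAt)
      (by fun_prop)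
    exact nhdsWithin_le_nhds (this (e.open_source.mem_nhds (by simpa using hse)))
  have hevξ : ∀ᶠ u in 𝓝[>] (0 : ℝ), ξ u ∈ e.source :=
    nhdsWithin_le_nhds ((hξ'.contMDiffAt (mem_univ 0)).continuousAt (e.open_source.mem_nhds hse'))
  obtain ⟨u, ⟨⟨hseg, hG⟩, hηu, hξu⟩, hu⟩ := ((hev.and (hevη.and hevξ)).and
    (Ioo_mem_nhdsGT (lt_min hs hδ))).exists
  have hus : u < s := hu.2.trans_le (min_le_left _ _)
  have huδ : u < δ := hu.2.trans_le (min_le_right _ _)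
  -- Together: R(η 0) ≤ (s - u) + θ u + (δ - u) + R(ξ δ) < s + δ + R(ξ δ), against `hle`.
  have h1 := hξ.escapeTime_le hξ1 u δ hesc
  have h2 := escapeTime_le_add (x := η (s - u)) h1.1 fun b hb ↦ by
    have := escapes_segment (g := g) he hseg (mul_pos hθ0 hu.1) hG (b := b)
      (by rwa [e.left_inv hξu])
    rwa [e.left_inv hηu] at this
  have h3 := (hη.escapeTime_le hη1 0 (s - u) h2.1).2
  have h4 := h1.2
  have h5 := h2.2
  rw [abs_of_nonpos (by linarith)] at h3 h4
  nlinarith [hu.1]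

theorem GeodesicallyComplete.not_escapes [T2Space M] (hg : GeodesicallyComplete g) (x : M)
    (b : ℝ) : ¬ Escapes g x b := by
  intro hb
  obtain ⟨η, hη, hη1, rfl, δ, hδ, hδe, hδR⟩ := hg.exists_descent ⟨b, hb⟩
  set R := escapeTime g (η 0)
  set A : Set ℝ := {s | (∃ b, Escapes g (η s) b) ∧ s + escapeTime g (η s) ≤ R}
  have hδA : δ ∈ A := ⟨hδe, hδR⟩
  have hA : BddAbove A := ⟨R, fun s hs ↦ by linarith [hs.2, escapeTime_nonneg g (η s)]⟩
  have hδs : δ ≤ sSup A := le_csSup hA hδA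
  -- Along η the escape time changes by at most the elapsed time, so the inequality passes to the
  -- supremum.
  have hmem : sSup A ∈ A := by
    refine ⟨(hη.escapeTime_le hη1 (sSup A) δ hδe).1, le_of_forall_pos_le_add fun ε hε ↦ ?_⟩
    obtain ⟨s, hs, hlt⟩ := exists_lt_of_lt_csSup ⟨δ, hδA⟩
      (sub_lt_self (sSup A) (half_pos hε))
    have h1 := (hη.escapeTime_le hη1 (sSup A) s hs.1).2
    rw [abs_of_nonneg (sub_nonneg.2 (le_csSup hA hs))] at h1
    linarith [hs.2]
  set s := sSup A
  -- The second descent starts at the last admissible time; once ξ is identified with η shifted by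
  -- `s`, the time `δ' + s` is admissible too.
  obtain ⟨ξ, hξ, hξ1, hξ0, δ', hδ', hδe', hδR'⟩ := hg.exists_descent hmem.1
  have he : chartAt E (η s) ∈ IsManifold.maximalAtlas 𝓘(ℝ, E) ∞ M :=
    IsManifold.chart_mem_maximalAtlas _
  have hse : η s ∈ (chartAt E (η s)).source := mem_chart_source E (η s)
  have hderiv := deriv_eq_of_escapeTime hη hη1 hξ hξ1 (hδ.trans_le hδs) hδ' hξ0 hδe'
    (by linarith [hmem.2]) he hse
  have hshift := ((isGeodesic_iff _ _ _).1 hη).comp_add_const s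
  rw [preimage_univ] at hshift
  have hev := hshift.eventuallyEq ((isGeodesic_iff _ _ _).1 hξ) he (mem_univ 0)
    (by simp) (by simpa using hξ0.symm) (by
      rw [deriv_comp_add_const (fun t ↦ chartAt E (η s) (η t)) s 0, zero_add, hderiv])
  have heq := hshift.eqOn ((isGeodesic_iff _ _ _).1 hξ) (mem_univ 0) hev (mem_univ δ')
  have hA' : δ' + s ∈ A := by
    have heq' : η (δ' + s) = ξ δ' := heq
    refine ⟨heq' ▸ hδe', ?_⟩
    rw [heq']
    linarith [hmem.2]
  linarith [le_csSup hA hA']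

end NoEscape

/-! ### Extension of magnetic curves past a finite end -/

section Extension

/-- Running from `a` towards `b` with a parameter in [0, 1) treats left and right ends of `J` alike.
-/
theorem IsOpenInterval.exists_endpoint {J : Set ℝ} (hJ : IsOpenInterval J) (hne : J ≠ univ) :
    ∃ a ∈ J, ∃ b ∉ J, ∀ s ∈ Ico (0 : ℝ) 1, a + s * (b - a) ∈ J := by
  obtain ⟨a, ha⟩ := hJ.1
  obtain ⟨p, hp⟩ := (ne_univ_iff_exists_notMem J).1 hne
  set Z : Set ℝ := Icc 0 1 ∩ {s | a + s * (p - a) ∈ Jᶜ} with hZ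
  have hZc : IsClosed Z := isClosed_Icc.inter
    (hJ.2.1.isClosed_compl.preimage (by fun_prop : Continuous fun s : ℝ ↦ a + s * (p - a)))
  have hZb : BddBelow Z := ⟨0, fun s hs ↦ hs.1.1⟩
  have hmem : sInf Z ∈ Z := hZc.csInf_mem ⟨1, by simp, by simpa using hp⟩ hZb
  have hpos : 0 < sInf Z := by
    refine hmem.1.1.lt_of_ne fun h0 ↦ hmem.2 ?_
    rw [← h0]
    simpa using ha
  refine ⟨a, ha, a + sInf Z * (p - a), hmem.2, fun s hs ↦ ?_⟩
  by_contra hs'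
  have : s * sInf Z ∈ Z := by
    refine ⟨⟨mul_nonneg hs.1 hpos.le, mul_le_one₀ hs.2.le hpos.le hmem.1.2⟩, fun h ↦ hs' ?_⟩
    convert h using 1
    ring
  nlinarith [csInf_le hZb this, hs.2]

/-- The solutions of an ordinary differential equation with nearby initial values exist for a
uniform time, and do not leave a given neighbourhood. -/
theorem exists_uniform_local_solution {V : Type*} [NormedAddCommGroup V] [NormedSpace ℝ V]
    [CompleteSpace V] {Y : V → V} {z : V} (hY : ContDiffAt ℝ 1 Y z) {U : Set V} (hU : U ∈ 𝓝 z) :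
    ∃ ε > (0 : ℝ), ∀ᶠ z' in 𝓝 z, ∃ α : ℝ → V, α 0 = z' ∧
      ∀ t ∈ Ioo (-ε) ε, HasDerivAt α (Y (α t)) t ∧ α t ∈ U := by
  obtain ⟨δ, hδ, a, r, L, K, hr, h⟩ := IsPicardLindelof.of_contDiffAt_one hY
  obtain ⟨α, hα, hαc⟩ := (h 0).exists_forall_mem_closedBall_eq_hasDerivWithinAt_continuousOn
  simp only [zero_sub, zero_add] at hα hαc
  have hr' : Metric.closedBall z (r : ℝ) ∈ 𝓝 z := Metric.closedBall_mem_nhds z hr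
  -- Joint continuity of the local flow in initial value and time gives a common time during which
  -- nearby solutions stay in `U`.
  have hc : ContinuousAt α (z, 0) :=
    hαc.continuousAt (prod_mem_nhds hr' (Icc_mem_nhds (neg_lt_zero.2 hδ) hδ))
  have hz : α (z, 0) = z := (hα z (mem_of_mem_nhds hr')).1
  have hN : α ⁻¹' U ∈ 𝓝 (z, (0 : ℝ)) := hc (by rwa [hz])
  obtain ⟨A, hA, B, hB, hAB⟩ := mem_nhds_prod_iff.1 hN
  obtain ⟨η, hη, hηB⟩ := Metric.mem_nhds_iff.1 hB
  refine ⟨min δ η, lt_min hδ hη, ?_⟩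
  filter_upwards [hr', hA] with z' hz' hzA
  refine ⟨fun t ↦ α (z', t), (hα z' hz').1, fun t ht ↦ ⟨?_, ?_⟩⟩
  · have h1 : -δ < t := by linarith [ht.1, min_le_left δ η]
    have h2 : t < δ := by linarith [ht.2, min_le_left δ η]
    exact ((hα z' hz').2 t ⟨h1.le, h2.le⟩).hasDerivAt (Icc_mem_nhds h1 h2)
  · refine hAB ⟨hzA, hηB ?_⟩
    rw [Metric.mem_ball, dist_zero_right, Real.norm_eq_abs, abs_lt]
    exact ⟨by linarith [ht.1, min_le_right δ η], by linarith [ht.2, min_le_right δ η]⟩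

variable {E : Type*} [NormedAddCommGroup E] [NormedSpace ℝ E] [FiniteDimensional ℝ E]
  {M : Type*} [TopologicalSpace M] [ChartedSpace E M] [IsManifold 𝓘(ℝ, E) ∞ M]
  {g : RiemMetric E M} {F : MagneticField E M} {γ : ℝ → M} {J : Set ℝ}

theorem IsMagneticCurve.exists_union [T2Space M] (h : IsMagneticCurve g F γ J) {ξ : ℝ → M}
    {I : Set ℝ} (hξ : IsMagneticCurve g F ξ I) {t : ℝ} (htJ : t ∈ J) (htI : t ∈ I)
    {e : OpenPartialHomeomorph M E} (he : e ∈ IsManifold.maximalAtlas 𝓘(ℝ, E) ∞ M)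
    (hs : γ t ∈ e.source) (h0 : γ t = ξ t)
    (h1 : deriv (fun s ↦ e (γ s)) t = deriv (fun s ↦ e (ξ s)) t) :
    ∃ η : ℝ → M, IsMagneticCurve g F η (J ∪ I) ∧ EqOn η γ J := by
  classical
  have hJI : IsOpenInterval (J ∩ I) := ⟨⟨t, htJ, htI⟩, h.1.2.1.inter hξ.1.2.1, h.1.2.2.inter hξ.1.2.2⟩
  have hU : IsOpenInterval (J ∪ I) := ⟨⟨t, Or.inl htJ⟩, h.1.2.1.union hξ.1.2.1,
    (h.1.2.2.isPreconnected.union t htJ htI hξ.1.2.2.isPreconnected).ordConnected⟩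
  have hγ' := h.mono hJI inter_subset_left
  have hξ' := hξ.mono hJI inter_subset_right
  have heq := hγ'.eqOn hξ' ⟨htJ, htI⟩ (hγ'.eventuallyEq hξ' he ⟨htJ, htI⟩ hs h0 h1)
  refine ⟨J.piecewise γ ξ, isMagneticCurve_of_locally hU fun u hu ↦ ?_, J.piecewise_eqOn γ ξ⟩
  rcases hu with hu | hu
  · refine ⟨γ, J, h, hu, ?_⟩
    filter_upwards [h.1.2.1.mem_nhds hu] with v hv
    rw [piecewise_eq_of_mem _ _ _ hv]
  · refine ⟨ξ, I, hξ, hu, ?_⟩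
    filter_upwards [hξ.1.2.1.mem_nhds hu] with v hv
    by_cases hvJ : v ∈ J
    · rw [piecewise_eq_of_mem _ _ _ hvJ, heq ⟨hvJ, hv⟩]
    · rw [piecewise_eq_of_notMem _ _ _ hvJ]

/-- Magnetic curves whose positions and velocities are close to a given one in a chart extend
for a uniform time. -/
theorem exists_uniform_extension [T2Space M] (g : RiemMetric E M) (F : MagneticField E M)
    {e : OpenPartialHomeomorph M E} (he : e ∈ IsManifold.maximalAtlas 𝓘(ℝ, E) ∞ M) {z : E × E}
    (hz : z.1 ∈ e.target) :
    ∃ ε > (0 : ℝ), ∀ᶠ z' in 𝓝 z, ∀ (γ : ℝ → M) (J : Set ℝ), IsMagneticCurve g F γ J →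
      ∀ t ∈ J, γ t ∈ e.source → (e (γ t), deriv (fun s ↦ e (γ s)) t) = z' →
        ∃ η : ℝ → M, IsMagneticCurve g F η (J ∪ Ioo (t - ε) (t + ε)) ∧ EqOn η γ J := by
  have hU : e.target ×ˢ univ ∈ 𝓝 z := (e.open_target.prod isOpen_univ).mem_nhds ⟨hz, mem_univ _⟩
  have hY : ContDiffAt ℝ 1 (fun p : E × E ↦ (p.2, coordForce g F e p)) z :=
    contDiffAt_snd.prodMk (((contDiffOn_coordForce g F he).contDiffAt hU).of_le (by norm_cast))
  obtain ⟨ε, hε, hev⟩ := exists_uniform_local_solution hY hU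
  refine ⟨ε, hε, hev.mono ?_⟩
  rintro z' ⟨α, hα0, hα⟩ γ J h t ht hs rfl
  have hI : IsOpenInterval (Ioo (t - ε) (t + ε)) := isOpenInterval_Ioo (by linarith)
  have htI : t ∈ Ioo (t - ε) (t + ε) := ⟨by linarith, by linarith⟩
  have hβ (s : ℝ) (hs : s ∈ Ioo (t - ε) (t + ε)) : HasDerivAt (fun s ↦ α (s - t))
      ((α (s - t)).2, coordForce g F e (α (s - t))) s ∧ α (s - t) ∈ e.target ×ˢ univ := by
    have hm : s - t ∈ Ioo (-ε) ε := ⟨by linarith [hs.1], by linarith [hs.2]⟩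
    exact ⟨(hα _ hm).1.comp_sub_const s t, (hα _ hm).2⟩
  have hξ := isMagneticCurve_symm_comp g F he hI (fun s hs ↦ (hβ s hs).1.fst)
    (fun s hs ↦ (hβ s hs).1.snd) (fun s hs ↦ (hβ s hs).2.1)
  have hα0' : α (t - t) = (e (γ t), deriv (fun s ↦ e (γ s)) t) := by rw [sub_self, hα0]
  refine h.exists_union hξ ht htI he hs (by simp [hα0, e.left_inv hs]) ?_
  have hev : (fun s ↦ e (e.symm (α (s - t)).1)) =ᶠ[𝓝 t] fun s ↦ (α (s - t)).1 := by
    filter_upwards [hI.2.1.mem_nhds htI] with s hs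
    exact e.right_inv (hβ s hs).2.1
  have hd : HasDerivAt (fun s ↦ (α (s - t)).1) (α (t - t)).2 t := (hβ t htI).1.fst
  rw [hev.deriv_eq, hd.deriv, hα0']

/-- A magnetic curve which stays in a compact set up to a finite endpoint of its domain extends
beyond that endpoint. -/
theorem IsMagneticCurve.exists_extension [T2Space M] (h : IsMagneticCurve g F γ J) {l : Filter ℝ}
    [l.NeBot] {b : ℝ} (hl : l ≤ 𝓝 b) (hlJ : ∀ᶠ t in l, t ∈ J) {K : Set M} (hK : IsCompact K)
    (hlK : ∀ᶠ t in l, γ t ∈ K) :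
    ∃ (η : ℝ → M) (I : Set ℝ), IsMagneticCurve g F η I ∧ J ⊆ I ∧ b ∈ I ∧ EqOn η γ J := by
  obtain ⟨t₀, ht₀⟩ := h.1.1
  obtain ⟨q, -, hq⟩ := hK.exists_mapClusterPt (f := l) (u := γ) (le_principal_iff.2 hlK)
  set e := chartAt E q
  have he : e ∈ IsManifold.maximalAtlas 𝓘(ℝ, E) ∞ M := IsManifold.chart_mem_maximalAtlas q
  have hqs : q ∈ e.source := mem_chart_source E q
  have hqt := e.map_source hqs
  obtain ⟨m, hm, hcoer⟩ := exists_eventually_coercive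
    (((contDiffOn_localRep_inner g he).contDiffAt (e.open_target.mem_nhds hqt)).continuousAt)
    fun v hv ↦ localRep_inner_pos g he hqt hv
  obtain ⟨r, hr, hrs⟩ := Metric.nhds_basis_closedBall.mem_iff.1
    (inter_mem hcoer (e.open_target.mem_nhds hqt))
  set W := e.source ∩ e ⁻¹' Metric.closedBall (e q) r
  have hW : W ∈ 𝓝 q := inter_mem (e.open_source.mem_nhds hqs)
    (e.continuousAt hqs (Metric.closedBall_mem_nhds _ hr))
  have hfreq : ∃ᶠ t in l, γ t ∈ W := hq.frequently hW
  -- The point `q` is only a cluster point, so attention is restricted to the times at which γ is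
  -- near `q`.
  set l' := l ⊓ 𝓟 {t | γ t ∈ W}
  have : l'.NeBot := frequently_mem_iff_neBot.1 hfreq
  have hl'W : ∀ᶠ t in l', γ t ∈ W := mem_inf_of_right (mem_principal_self _)
  have hl'J : ∀ᶠ t in l', t ∈ J := hlJ.filter_mono inf_le_left
  set κ := speedSq g γ t₀
  set C := Metric.closedBall (e q) r ×ˢ Metric.closedBall (0 : E) √(κ / m)
  -- Near `q` one has m‖v‖² ≤ g(v, v), and the right side is constant along the curve, so the
  -- coordinate velocities are bounded.
  have hC : ∀ᶠ t in l', (e (γ t), deriv (fun s ↦ e (γ s)) t) ∈ C := by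
    filter_upwards [hl'W, hl'J] with t htW htJ
    refine ⟨htW.2, ?_⟩
    have h1 := (hrs htW.2).1 (deriv (fun s ↦ e (γ s)) t)
    rw [← speedSq_eq_localRep g he ((h.contMDiffAt htJ).mdifferentiableAt (by simp)) htW.1,
      h.speedSq_eq htJ ht₀] at h1
    rw [mem_closedBall_zero_iff]
    exact Real.le_sqrt_of_sq_le ((le_div_iff₀' hm).2 h1)
  obtain ⟨z, hz, hzc⟩ := ((isCompact_closedBall (e q) r).prod
    (isCompact_closedBall (0 : E) √(κ / m))).exists_mapClusterPt (f := l')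
    (u := fun t ↦ (e (γ t), deriv (fun s ↦ e (γ s)) t)) (le_principal_iff.2 hC)
  obtain ⟨ε, hε, hext⟩ := exists_uniform_extension g F he (z := z) (hrs hz.1).2
  have hb : ∀ᶠ t in l', t ∈ Ioo (b - ε) (b + ε) :=
    (inf_le_left.trans hl) (Ioo_mem_nhds (by linarith) (by linarith))
  -- At such a time the state is close to `z`, so the curve extends by ε beyond `t`, and `b` is
  -- nearer than that.
  obtain ⟨t, ht, htW, htJ, htb⟩ := ((hzc.frequently hext).and_eventually
    (hl'W.and (hl'J.and hb))).exists
  obtain ⟨η, hη, heq⟩ := ht γ J h t htJ htW.1 rfl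
  exact ⟨η, _, hη, subset_union_left, Or.inr ⟨by linarith [htb.2], by linarith [htb.1]⟩, heq⟩

theorem GeodesicallyComplete.exists_extension_of_ne_univ [T2Space M] (hg : GeodesicallyComplete g)
    (h : IsMagneticCurve g F γ J) (hJ : J ≠ univ) :
    ∃ (η : ℝ → M) (I : Set ℝ), IsMagneticCurve g F η I ∧ J ⊂ I ∧ EqOn η γ J := by
  obtain ⟨a, ha, b, hb, hab⟩ := h.1.exists_endpoint hJ
  have hba : b - a ≠ 0 := sub_ne_zero.2 fun hba ↦ hb (hba ▸ ha)
  set κ := speedSq g γ a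
  have hκ : 0 ≤ κ := by
    by_cases h0 : (velocity γ a : TangentSpace 𝓘(ℝ, E) (γ a)) = 0
    · simp [κ, speedSq, h0]
    · exact (g.pos _ _ h0).le
  -- Here κ is the squared speed and |k| = 1 / (κ + 1), so k² κ ≤ 1 without a separate case κ = 0; k
  -- is negative at a left end.
  set B := |b - a| * (κ + 1)
  have hB : 0 < B := mul_pos (abs_pos.2 hba) (by linarith)
  set k := (b - a) / B
  have hk : k ^ 2 * κ ≤ 1 := by
    have : k ^ 2 = 1 / (κ + 1) ^ 2 := by
      rw [div_pow, mul_pow, sq_abs]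
      field_simp
    rw [this, one_div_mul_eq_div, div_le_one (by positivity)]
    nlinarith
  have hm {s : ℝ} (hs : s ∈ Ico 0 B) : a + k * s ∈ J := by
    convert hab (s / B) ⟨div_nonneg hs.1 hB.le, (div_lt_one hB).2 hs.2⟩ using 1
    ring
  have hnot := hg.not_escapes (γ a) B
  -- The rescaled curve is slow and cannot escape in the time `B`, so from some time on it stays in
  -- a compact set.
  obtain ⟨K, hK, s₀, hs₀, hKs⟩ : ∃ K : Set M, IsCompact K ∧ ∃ s ∈ Ico 0 B, ∀ t ∈ Ico s B,
      γ (a + k * t) ∈ K := by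
    by_contra! hcon
    refine hnot ⟨fun s ↦ γ (a + k * s), hB, by simp, ?_, fun s hs ↦ ?_, hcon⟩
    · exact h.2.1.continuousOn.comp (by fun_prop) fun s hs ↦ hm hs
    · exact h.isSlowAt (hm hs) (by rwa [h.speedSq_eq (hm hs) ha])
  have hIco : ∀ᶠ s in 𝓝[<] B, s ∈ Ico s₀ B := Ico_mem_nhdsLT hs₀.2
  have hlim : Tendsto (fun s ↦ a + k * s) (𝓝[<] B) (𝓝 b) := by
    have h1 : a + k * B = b := by simp only [k]; field_simp; ring
    have h2 : Continuous fun s ↦ a + k * s := by fun_prop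
    exact h1 ▸ (h2.tendsto B).mono_left nhdsWithin_le_nhds
  obtain ⟨η, I, hη, hJI, hbI, heq⟩ := h.exists_extension (l := map (fun s ↦ a + k * s) (𝓝[<] B))
    hlim (eventually_map.2 (hIco.mono fun s hs ↦ hm ⟨hs₀.1.trans hs.1, hs.2⟩)) hK
    (eventually_map.2 (hIco.mono hKs))
  exact ⟨η, I, hη, ⟨hJI, fun hIJ ↦ hb (hIJ hbI)⟩, heq⟩

end Extension

end MagneticCurves

end

open MagneticCurves in
theorem mainTheorem4 {E : Type*} [NormedAddCommGroup E] [NormedSpace ℝ E] [FiniteDimensional ℝ E]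
    {M : Type*} [TopologicalSpace M] [T2Space M] [ChartedSpace E M] [IsManifold 𝓘(ℝ, E) ∞ M]
    (g : RiemMetric E M) (hg : GeodesicallyComplete g) (F : MagneticField E M)
    (γ : ℝ → M) (J : Set ℝ) (hγ : IsInextendible (IsMagneticCurve g F) γ J) :
    J = univ := by
  by_contra hJ
  obtain ⟨η, I, hη, hJI, heq⟩ := hg.exists_extension_of_ne_univ hγ.1 hJ
  exact hJI.ne (hγ.2 η I hη hJI.subset heq).symm
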